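/- Let $\varphi: 0\mapsto 01,\ 1\mapsto 0$ be the Fibonacci substitution, let $x_\varphi=\dots01001001\cdot0100101001\dots\in\{0,1\}^{\mathbb Z}$ be the two-sided fixed point of $\varphi^2$ with letter $1$ at coordinate $-1$ and letter $0$ at coordinate $0$, and let $X_\varphi$ be the closure of its orbit under the shift $\sigma$ (the Fibonacci system). Let $X^{[2]}$ be its $2$-block presentation, i.e. the set of all sequences $(\Psi(x_nx_{n+1}))_{n\in\mathbb Z}$ with $x\in X_\varphi$, where the $2$-blocks that occur are coded by $\Psi(01)=1$, $\Psi(10)=2$, $\Psi(00)=3$. Let $\pi$ be the letter-to-letter map $\pi(1)=\pi(2)=0$, $\pi(3)=1$, and let $Y=\pi(X^{[2]})\subseteq\{0,1\}^{\mathbb Z}$. Then: 1. $Y$ consists exactly of the shifts $\sigma^k(\delta(x))$, $k\in\mathbb Z$, $x\in X_\varphi$, where $\delta(x)=\cdots\delta(x_{-1})\cdot\delta(x_0)\delta(x_1)\cdots$ is obtained from $x$ by doubling every $0$, that is, $\delta(0)=00$, $\delta(1)=1$. 2. $(Y,\sigma)$ is topologically conjugate to $(X_\varphi,\sigma)$: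 there is a homeomorphism $h:X_\varphi\to Y$ with $h\sigma=\sigma h$. 3. Every sequence in $Y$ contains the word $0000$ and no other fourth power: if $w$ is a non-empty word, then $wwww$ occurs in a given $y\in Y$ if and only if $w=0$. 4. $Y$ cannot be generated by a substitution. Precisely, let $A$ be any finite alphabet containing $0$ and $1$, let $\eta$ be any substitution on $A$ (a map from letters to non-empty words over $A$, not necessarily primitive or injective), and let $X_\eta$ be the set of all $x\in A^{\mathbb Z}$ all of whose finite subwords are subwords of some $\eta^k(a)$, $a\in A$, $k\ge0$. Then $Y\neq X_\eta$, and also $Y$ is not the closure of the shift orbit of any point $x\in X_\eta$ with $\eta^k(x)=x$ for some $k\ge1$. -/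

import Mathlib

namespace FibDouble

/-- The `k`-th power of the shift on two-sided sequences; the shift `σ` itself is `shift 1`. -/
def shift {A : Type*} (k : ℤ) (x : ℤ → A) : ℤ → A := fun n => x (n + k)

/-- The word `w` occurs in the two-sided sequence `x`. -/
def Occurs {A : Type*} (w : List A) (x : ℤ → A) : Prop :=
  ∃ i : ℤ, ∀ (j : ℕ) (h : j < w.length), x (i + j) = w[j]

/-- The closure, in the product topology, of the orbit of `x` under the shift. -/
def orbitClosure {A : Type*} [TopologicalSpace A] (x : ℤ → A) : Set (ℤ → A) :=
  closure (Set.range fun k : ℤ => shift k x)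

/-- Topological conjugacy of shift-invariant sets of sequences: a homeomorphism `h` with
`h σ = σ h`. -/
def Conjugate {A B : Type*} [TopologicalSpace A] [TopologicalSpace B]
    (X : Set (ℤ → A)) (Y : Set (ℤ → B)) : Prop :=
  ∃ h : X ≃ₜ Y, ∀ x : X, ∃ hx : shift 1 (x : ℤ → A) ∈ X,
    (h ⟨shift 1 (x : ℤ → A), hx⟩ : ℤ → B) = shift 1 (h x : ℤ → B)

/-- The word `η^k(a)`, where `η` is extended to words by concatenation. -/
def iter {A : Type*} (η : A → List A) (k : ℕ) (a : A) : List A :=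
  (fun w : List A => w.flatMap η)^[k] [a]

/-- `y` is the sequence `… θ(x₋₁) · θ(x₀) θ(x₁) …`, where `θ(x₀)` starts at coordinate `0`;
`c n` is the coordinate at which `θ(xₙ)` starts. -/
def IsImage {A B : Type*} (θ : A → List B) (x : ℤ → A) (y : ℤ → B) : Prop :=
  ∃ c : ℤ → ℤ, c 0 = 0 ∧ ∀ n : ℤ,
    c (n + 1) = c n + (θ (x n)).length ∧
    ∀ (j : ℕ) (h : j < (θ (x n)).length), y (c n + j) = (θ (x n))[j]

/-- The system `X_η` of a substitution `η`: the two-sided sequences all of whose finite words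
are subwords of some `η^k(a)`. -/
def system {A : Type*} (η : A → List A) : Set (ℤ → A) :=
  {x | ∀ (i : ℤ) (n : ℕ), ∃ (a : A) (k : ℕ),
    (List.ofFn fun j : Fin n => x (i + (j : ℕ))) <:+: iter η k a}

/-- The Fibonacci substitution `0 ↦ 01`, `1 ↦ 0`. -/
def fib : Fin 2 → List (Fin 2) := ![[0, 1], [0]]

/-- The two-sided fixed point `… 01001001 · 0100101001 …` of `fib²`: to the right of the dot
the limit of the words `fib^k(0)`, each of which is a prefix of the next, and to the left of the
dot the limit of the words `fib^(2k)(1)`, each of which is a suffix of the next. -/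
def fibPoint : ℤ → Fin 2
  | Int.ofNat n => (iter fib (n + 1) 0).getD n 0
  | Int.negSucc n => (iter fib (2 * (n + 1)) 1).reverse.getD n 0

/-- The Fibonacci system `X_φ`. -/
def fibSystem : Set (ℤ → Fin 2) := orbitClosure fibPoint

/-- The coding `[01] ↦ 1`, `[10] ↦ 2`, `[00] ↦ 3` of the `2`-blocks of the Fibonacci system
(the value `0` is never used there, as `11` does not occur). -/
def blockCode : Fin 2 → Fin 2 → Fin 4 := ![![3, 1], ![2, 0]]

/-- The `2`-block presentation of the Fibonacci system, over the letters `1, 2, 3`. -/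
def twoBlockSystem : Set (ℤ → Fin 4) :=
  (fun (x : ℤ → Fin 2) (n : ℤ) => blockCode (x n) (x (n + 1))) '' fibSystem

/-- The letter-to-letter map `1 ↦ 0`, `2 ↦ 0`, `3 ↦ 1`. -/
def letterMap (b : Fin 4) : Fin 2 := if b = 3 then 1 else 0

/-- The image of the `2`-block presentation under the letter-to-letter map. -/
def doubledSystem : Set (ℤ → Fin 2) :=
  (fun (z : ℤ → Fin 4) (n : ℤ) => letterMap (z n)) '' twoBlockSystem

/-- The map `0 ↦ 00`, `1 ↦ 1`, which doubles the letter `0`. -/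
def double : Fin 2 → List (Fin 2) := ![[0, 0], [1]]

end FibDouble

namespace FibDouble

/-! The main tool is desubstitution: up to a shift, every `x` in the Fibonacci system is the
`fib`-image of some `x'` in it, and the blocks 01 and 0 of this image start exactly at the 0's of
`x` (`exists_cutBy`, `CutBy.exists_cut`).

The block map `code` writes 1 exactly where 00 starts. In a `fib`-image a block 01 is followed by 0
and is coded 00, while a block 0 coming from the letter 1 is coded 1. So `code` after `fib` is the
doubling map, with the same cuts (`CutBy.code`). As 11 never occurs, a coded 0 says that two
neighbours differ, so the code and one known letter determine `x`. Hence `code` is injective, and by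
compactness a conjugacy.

Give 0 and 1 the weights φ and 1, so that `fib` multiplies weights by φ. Descent by desubstitution
bounds the weight of a word with period `p` by 2 + φ < 4 times the weight of one period
(`weight_le_of_period`), so the Fibonacci system has no fourth powers. A fourth power in Y that
contains a 1 would lift to one in the Fibonacci system; one made of 0's can only be 0000, since
00000 does not occur.

If a substitution generated Y, some power `η^k` would map a point of Y to a point of Y. Then `η^k`
fixes the letters 0 and 1 (`eq_id_of_isImage`). But words over fixed letters grow inside `η^j(c)`
only by repeating one block, so those without fifth powers have bounded length
(`exists_length_le_of_fifthPowerFree`). All words of Y are free of fifth powers and they are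
arbitrarily long, a contradiction. -/

/-- The word `w` occurs in the two-sided sequence `x` at coordinate `i`. -/
def OccursAt {A : Type*} (w : List A) (x : ℤ → A) (i : ℤ) : Prop :=
  ∀ (j : ℕ) (h : j < w.length), x (i + j) = w[j]

/-! ### Occurrences and windows of two-sided sequences -/

section Words

variable {A B : Type*}

@[simp] theorem occursAt_nil (x : ℤ → A) (i : ℤ) : OccursAt [] x i :=
  fun j h => absurd h (by simp)

@[simp] theorem occursAt_cons {a : A} {w : List A} {x : ℤ → A} {i : ℤ} :
    OccursAt (a :: w) x i ↔ x i = a ∧ OccursAt w x (i + 1) := by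
  constructor
  · intro h
    refine ⟨by have := h 0 (by simp); rwa [Nat.cast_zero, add_zero] at this, fun j hj => ?_⟩
    have := h (j + 1) (by simpa using hj)
    rw [List.getElem_cons_succ] at this
    rw [← this]
    congr 1
    push_cast
    ring
  · rintro ⟨h0, h⟩ j hj
    cases j with
    | zero => simpa using h0
    | succ j =>
      rw [List.getElem_cons_succ, ← h j (by simpa using hj)]
      congr 1
      push_cast
      ring

theorem occursAt_append {u v : List A} {x : ℤ → A} {i : ℤ} :
    OccursAt (u ++ v) x i ↔ OccursAt u x i ∧ OccursAt v x (i + u.length) := by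
  induction u generalizing i with
  | nil => simp
  | cons a u ih =>
    simp only [List.cons_append, occursAt_cons, ih, and_assoc, List.length_cons]
    push_cast
    rw [show i + 1 + (u.length : ℤ) = i + (u.length + 1) by ring]

theorem OccursAt.occurs {w : List A} {x : ℤ → A} {i : ℤ} (h : OccursAt w x i) : Occurs w x :=
  ⟨i, h⟩

theorem Occurs.of_infix {u w : List A} {x : ℤ → A} (h : Occurs w x) (hu : u <:+: w) :
    Occurs u x := by
  obtain ⟨i, h⟩ := h
  obtain ⟨s, t, rfl⟩ := hu
  exact ⟨_, (occursAt_append.1 (occursAt_append.1 h).1).2⟩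

theorem occursAt_shift {w : List A} {x : ℤ → A} {k i : ℤ} :
    OccursAt w (shift k x) i ↔ OccursAt w x (i + k) := by
  simp only [OccursAt, shift, add_right_comm]

theorem occursAt_map {e : A → B} (he : Function.Injective e) {w : List A} {x : ℤ → A} {i : ℤ} :
    OccursAt (w.map e) (fun n => e (x n)) i ↔ OccursAt w x i := by
  simp [OccursAt, he.eq_iff]

theorem OccursAt.eq_of_length_eq {u v : List A} {x : ℤ → A} {i : ℤ} (hu : OccursAt u x i)
    (hv : OccursAt v x i) (h : u.length = v.length) : u = v :=
  List.ext_getElem h fun j h₁ h₂ => by rw [← hu j h₁, ← hv j h₂]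

/-- The word of length `n` that occurs in `x` at coordinate `i`. -/
def window (x : ℤ → A) (i : ℤ) (n : ℕ) : List A := List.ofFn fun j : Fin n => x (i + (j : ℕ))

@[simp] theorem length_window (x : ℤ → A) (i : ℤ) (n : ℕ) : (window x i n).length = n := by
  simp [window]

theorem occursAt_window (x : ℤ → A) (i : ℤ) (n : ℕ) : OccursAt (window x i n) x i := by
  intro j h
  simp [window]

theorem OccursAt.eq_window {w : List A} {x : ℤ → A} {i : ℤ} (h : OccursAt w x i) :
    w = window x i w.length :=
  h.eq_of_length_eq (occursAt_window _ _ _) (by simp)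

theorem window_add (x : ℤ → A) (i : ℤ) (m n : ℕ) :
    window x i (m + n) = window x i m ++ window x (i + m) n :=
  (occursAt_window x i (m + n)).eq_of_length_eq
    (occursAt_append.2 ⟨occursAt_window _ _ _, by simpa using occursAt_window _ _ _⟩) (by simp)

theorem window_infix_window (x : ℤ → A) {i i' : ℤ} {n n' : ℕ} (h : i' ≤ i)
    (h' : i + n ≤ i' + n') : window x i n <:+: window x i' n' := by
  obtain ⟨m, rfl⟩ := Int.le.dest h
  obtain ⟨k, rfl⟩ : ∃ k : ℕ, n' = m + n + k := ⟨n' - (m + n), by omega⟩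
  rw [window_add, window_add]
  exact ⟨_, _, rfl⟩

theorem mem_of_mem_window {x : ℤ → A} {i : ℤ} {n : ℕ} {a : A} (h : a ∈ window x i n) :
    ∃ j, x j = a := by
  simp only [window, List.mem_ofFn] at h
  obtain ⟨j, hj⟩ := h
  exact ⟨_, hj⟩

end Words

/-! ### Iterates of a substitution -/

section Iter

variable {A : Type*} (η : A → List A)

@[simp] theorem iter_zero (a : A) : iter η 0 a = [a] := rfl

theorem iterate_flatMap (k : ℕ) (w : List A) :
    (fun w : List A => w.flatMap η)^[k] w = w.flatMap (iter η k) := by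
  induction k generalizing w with
  | zero => exact (List.flatMap_singleton' w).symm
  | succ k ih =>
    rw [Function.iterate_succ_apply, ih, List.flatMap_assoc]
    congr 1
    funext a
    rw [iter, Function.iterate_succ_apply, ih]
    simp

theorem iter_succ (k : ℕ) (a : A) : iter η (k + 1) a = (η a).flatMap (iter η k) := by
  rw [iter, Function.iterate_succ_apply, iterate_flatMap]
  simp

theorem iter_add (j k : ℕ) (a : A) : iter η (j + k) a = (iter η k a).flatMap (iter η j) := by
  rw [iter, Function.iterate_add_apply, iterate_flatMap]
  rfl

theorem iter_succ' (k : ℕ) (a : A) : iter η (k + 1) a = (iter η k a).flatMap η := by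
  rw [iter, Function.iterate_succ_apply']
  rfl

@[simp] theorem iter_one : iter η 1 = η := by
  funext a
  simp [iter_succ']

theorem iter_iter (j k : ℕ) : iter (iter η j) k = iter η (j * k) := by
  induction k with
  | zero => rfl
  | succ k ih =>
    funext a
    rw [iter_succ', ih, Nat.mul_succ, add_comm, iter_add]

variable {η}

theorem flatMap_ne_nil {B : Type*} {θ : A → List B} (hθ : ∀ a, θ a ≠ []) {w : List A}
    (hw : w ≠ []) : w.flatMap θ ≠ [] := by
  obtain ⟨a, w, rfl⟩ := List.exists_cons_of_ne_nil hw
  simp [hθ]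

theorem iter_ne_nil (hη : ∀ a, η a ≠ []) (k : ℕ) (a : A) : iter η k a ≠ [] := by
  induction k with
  | zero => simp
  | succ k ih =>
    rw [iter_succ']
    exact flatMap_ne_nil hη ih

theorem infix_flatMap {B : Type*} {u w : List A} (θ : A → List B) (h : u <:+: w) :
    u.flatMap θ <:+: w.flatMap θ := by
  obtain ⟨s, t, rfl⟩ := h
  exact ⟨s.flatMap θ, t.flatMap θ, by simp⟩

end Iter

/-! ### Images of two-sided sequences and their cut points -/

section Image

variable {A B : Type*} {θ : A → List B}

/-- `y` is obtained from `x` by the substitution `θ`, where `θ(xₙ)` starts at `c n`. -/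
def CutBy (θ : A → List B) (x : ℤ → A) (y : ℤ → B) (c : ℤ → ℤ) : Prop :=
  ∀ n : ℤ, c (n + 1) = c n + (θ (x n)).length ∧ OccursAt (θ (x n)) y (c n)

theorem isImage_iff {x : ℤ → A} {y : ℤ → B} :
    IsImage θ x y ↔ ∃ c : ℤ → ℤ, c 0 = 0 ∧ CutBy θ x y c := Iff.rfl

theorem exists_partial_sums {M : Type*} [AddCommGroup M] (l : ℤ → M) :
    ∃ c : ℤ → M, c 0 = 0 ∧ ∀ n, c (n + 1) = c n + l n := by
  refine ⟨fun n => ∑ i ∈ Finset.range n.toNat, l i -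
    ∑ i ∈ Finset.range (-n).toNat, l (-(i : ℤ) - 1), by simp, fun n => ?_⟩
  rcases le_or_gt 0 n with h | h
  · obtain ⟨k, rfl⟩ := Int.eq_ofNat_of_zero_le h
    simp only
    rw [show ((k : ℤ) + 1).toNat = k + 1 by omega, show (-((k : ℤ) + 1)).toNat = 0 by omega,
      show (-(k : ℤ)).toNat = 0 by omega, Finset.sum_range_succ]
    simp
  · obtain ⟨k, rfl⟩ : ∃ k : ℕ, n = -(k : ℤ) - 1 := ⟨(-n - 1).toNat, by omega⟩
    simp only
    rw [show (-(k : ℤ) - 1 + 1).toNat = 0 by omega, show (-(k : ℤ) - 1).toNat = 0 by omega,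
      show (-(-(k : ℤ) - 1 + 1)).toNat = k by omega, show (-(-(k : ℤ) - 1)).toNat = k + 1 by omega,
      Finset.sum_range_succ]
    simp

theorem CutBy.strictMono (hθ : ∀ a, θ a ≠ []) {x : ℤ → A} {y : ℤ → B} {c : ℤ → ℤ}
    (h : CutBy θ x y c) : StrictMono c :=
  strictMono_int_of_lt_succ fun n => by
    have := List.length_pos_of_ne_nil (hθ (x n))
    have := (h n).1
    omega

theorem add_le_of_strictMono {c : ℤ → ℤ} (hc : StrictMono c) {m n : ℤ} (h : m ≤ n) :
    c m + (n - m) ≤ c n := by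
  induction n, h using Int.leInduction with
  | base => simp
  | succ n _ ih =>
    have := hc (show n < n + 1 by omega)
    omega

theorem exists_between_cuts {c : ℤ → ℤ} (hc : StrictMono c) (m : ℤ) :
    ∃ n, c n ≤ m ∧ m < c (n + 1) := by
  obtain ⟨n, hn, hmax⟩ := Int.exists_greatest_of_bdd (P := fun n => c n ≤ m)
    ⟨max 0 (m - c 0), fun z hz => by
      rcases le_total z 0 with h | h
      · exact h.trans (le_max_left _ _)
      · have := add_le_of_strictMono hc h
        exact le_trans (by omega) (le_max_right _ _)⟩
    ⟨min 0 (m - c 0), by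
      have := add_le_of_strictMono hc (min_le_left 0 (m - c 0))
      have := min_le_right 0 (m - c 0)
      omega⟩
  refine ⟨n, hn, ?_⟩
  by_contra! h
  have := hmax (n + 1) h
  omega

theorem exists_isImage (hθ : ∀ a, θ a ≠ []) (x : ℤ → A) : ∃ y : ℤ → B, IsImage θ x y := by
  obtain ⟨c, hc0, hc⟩ := exists_partial_sums fun n => ((θ (x n)).length : ℤ)
  have hmono : StrictMono c := strictMono_int_of_lt_succ fun n => by
    have := List.length_pos_of_ne_nil (hθ (x n))
    have := hc n
    omega
  choose N hN1 hN2 using exists_between_cuts hmono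
  have hlt (m : ℤ) : (m - c (N m)).toNat < (θ (x (N m))).length := by
    have := hN1 m
    have := hN2 m
    have := hc (N m)
    omega
  refine ⟨fun m => (θ (x (N m)))[(m - c (N m)).toNat]'(hlt m), c, hc0, fun n => ⟨hc n, ?_⟩⟩
  intro j hj
  have hn : N (c n + j) = n := by
    have h1 := hN1 (c n + j)
    have h2 := hN2 (c n + j)
    have h3 := hc n
    have h4 : c n < c (N (c n + j) + 1) := by omega
    have h5 : c (N (c n + j)) < c (n + 1) := by omega
    have := hmono.lt_iff_lt.1 h4
    have := hmono.lt_iff_lt.1 h5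
    omega
  simp [hn]

theorem CutBy.occursAt_flatMap {x : ℤ → A} {y : ℤ → B} {c : ℤ → ℤ} (h : CutBy θ x y c)
    {w : List A} {n : ℤ} (hw : OccursAt w x n) :
    OccursAt (w.flatMap θ) y (c n) ∧ c (n + w.length) = c n + (w.flatMap θ).length := by
  induction w generalizing n with
  | nil => simp
  | cons a w ih =>
    obtain ⟨rfl, hw'⟩ := occursAt_cons.1 hw
    obtain ⟨h1, h2⟩ := ih hw'
    obtain ⟨h3, h4⟩ := h n
    rw [List.flatMap_cons, occursAt_append, ← h3]
    refine ⟨⟨h4, h1⟩, ?_⟩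
    rw [List.length_cons, List.length_append]
    push_cast
    rw [show n + ((w.length : ℤ) + 1) = n + 1 + w.length by ring, h2, h3]
    ring

theorem IsImage.occurs_flatMap {x : ℤ → A} {y : ℤ → B} (h : IsImage θ x y) {w : List A}
    (hw : Occurs w x) : Occurs (w.flatMap θ) y := by
  obtain ⟨c, -, h⟩ := isImage_iff.1 h
  obtain ⟨n, hw⟩ := hw
  exact (h.occursAt_flatMap hw).1.occurs

theorem CutBy.window_infix (hθ : ∀ a, θ a ≠ []) {x : ℤ → A} {y : ℤ → B} {c : ℤ → ℤ}
    (h : CutBy θ x y c) (i : ℤ) (n : ℕ) :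
    ∃ j m, window y i n <:+: (window x j m).flatMap θ := by
  have hc := h.strictMono hθ
  obtain ⟨a, ha, -⟩ := exists_between_cuts hc i
  obtain ⟨b, hb, hb'⟩ := exists_between_cuts hc (i + n)
  have hab : a < b + 1 := hc.lt_iff_lt.1 (by omega)
  obtain ⟨m, hm⟩ := Int.le.dest hab.le
  obtain ⟨h1, h2⟩ := h.occursAt_flatMap (occursAt_window x a m)
  refine ⟨a, m, ?_⟩
  rw [h1.eq_window]
  refine window_infix_window y ha ?_
  rw [length_window, hm] at h2
  omega

theorem IsImage.window_infix (hθ : ∀ a, θ a ≠ []) {x : ℤ → A} {y : ℤ → B}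
    (h : IsImage θ x y) (i : ℤ) (n : ℕ) :
    ∃ j m, window y i n <:+: (window x j m).flatMap θ := by
  obtain ⟨c, -, h⟩ := isImage_iff.1 h
  exact h.window_infix hθ i n

theorem CutBy.isImage_shift {x : ℤ → A} {y : ℤ → B} {c : ℤ → ℤ} (h : CutBy θ x y c) (k : ℤ) :
    IsImage θ (shift k x) (shift (c k) y) := by
  refine isImage_iff.2 ⟨fun n => c (n + k) - c k, by simp, fun n => ⟨?_, ?_⟩⟩
  · have := (h (n + k)).1
    simp only [shift]
    rw [show n + 1 + k = n + k + 1 by ring, this]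
    ring
  · rw [occursAt_shift]
    simpa [shift] using (h (n + k)).2

theorem cuts_eq {x x' : ℤ → A} {y y' : ℤ → B} {c c' : ℤ → ℤ} (h : CutBy θ x y c)
    (h' : CutBy θ x' y' c') (h0 : c 0 = 0) (h0' : c' 0 = 0) {N : ℤ}
    (hx : ∀ m, -N ≤ m → m ≤ N → x m = x' m) (m : ℤ) (hm : -N ≤ m) (hm' : m ≤ N + 1) :
    c m = c' m := by
  induction m using Int.induction_on with
  | zero => rw [h0, h0']
  | succ i ih => rw [(h _).1, (h' _).1, hx _ (by omega) (by omega), ih (by omega) (by omega)]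
  | pred i ih =>
    have h1 := (h (-(i : ℤ) - 1)).1
    have h2 := (h' (-(i : ℤ) - 1)).1
    rw [hx _ (by omega) (by omega)] at h1
    rw [sub_add_cancel] at h1 h2
    have := ih (by omega) (by omega)
    omega

/-- The letter at coordinate `n` of the image depends only on the letters at the coordinates
between `-|n|` and `|n|`. -/
theorem IsImage.eq_of_eqOn (hθ : ∀ a, θ a ≠ []) {x x' : ℤ → A} {y y' : ℤ → B}
    (h : IsImage θ x y) (h' : IsImage θ x' y') {n : ℤ}
    (hx : ∀ m, -|n| ≤ m → m ≤ |n| → x m = x' m) : y n = y' n := by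
  obtain ⟨c, h0, h⟩ := isImage_iff.1 h
  obtain ⟨c', h0', h'⟩ := isImage_iff.1 h'
  have hc := h.strictMono hθ
  obtain ⟨m, hm, hm'⟩ := exists_between_cuts hc n
  -- Since `c 0 = 0` and `c` is strictly increasing, `c` moves at least as fast as the index, so the
  -- block covering `n` has its index between `-|n|` and `|n|`.
  have hle : -|n| ≤ m := by
    by_contra! hlt
    have := neg_abs_le n
    have := add_le_of_strictMono hc (show m + 1 ≤ 0 by have := abs_nonneg n; omega)
    omega
  have hle' : m ≤ |n| := by
    by_contra! hlt
    have := le_abs_self n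
    have := add_le_of_strictMono hc (show 0 ≤ m by have := abs_nonneg n; omega)
    omega
  have e1 := cuts_eq h h' h0 h0' hx m hle (by omega)
  have h3 := (h m).1
  have h4 := (h m).2 (n - c m).toNat (by omega)
  have h5 := (h' m).2 (n - c m).toNat (by rw [← hx m hle hle']; omega)
  rw [← e1] at h5
  rw [show c m + ((n - c m).toNat : ℤ) = n by omega] at h4 h5
  rw [h4, h5]
  simp only [hx m hle hle']

theorem IsImage.unique (hθ : ∀ a, θ a ≠ []) {x : ℤ → A} {y y' : ℤ → B} (h : IsImage θ x y)
    (h' : IsImage θ x y') : y = y' :=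
  funext fun _ => h.eq_of_eqOn hθ h' fun _ _ _ => rfl

theorem shift_shift (j k : ℤ) (x : ℤ → A) : shift j (shift k x) = shift (j + k) x := by
  funext n
  simp [shift, add_assoc]

@[simp] theorem shift_zero (x : ℤ → A) : shift 0 x = x := by
  funext n
  simp [shift]

end Image

/-! ### Orbit closures and continuity of substitutions -/

section Topology

variable {A B : Type*} [TopologicalSpace A]

theorem continuous_shift (k : ℤ) : Continuous (shift k : (ℤ → A) → ℤ → A) :=
  continuous_pi fun n => continuous_apply (n + k)

theorem mem_closure_of_agree [DiscreteTopology A] {S : Set (ℤ → A)} {x : ℤ → A}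
    (h : ∀ N : ℕ, ∃ z ∈ S, ∀ m : ℤ, -N ≤ m → m ≤ N → z m = x m) :
    x ∈ closure S := by
  rw [mem_closure_iff_nhds]
  intro U hU
  rw [nhds_pi, Filter.mem_pi] at hU
  obtain ⟨I, hI, t, ht, hU⟩ := hU
  obtain ⟨N, hN⟩ : ∃ N : ℕ, ∀ i ∈ I, i.natAbs ≤ N := by
    obtain ⟨N, hN⟩ := (hI.image Int.natAbs).bddAbove
    exact ⟨N, fun i hi => hN ⟨i, hi, rfl⟩⟩
  obtain ⟨z, hz, hzx⟩ := h N
  refine ⟨z, hU fun i hi => ?_, hz⟩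
  rw [hzx i (by have := hN i hi; omega) (by have := hN i hi; omega)]
  exact mem_of_mem_nhds (ht i)

theorem eventually_agree [DiscreteTopology A] (x : ℤ → A) (N : ℤ) :
    ∀ᶠ z in nhds x, ∀ m : ℤ, -N ≤ m → m ≤ N → z m = x m := by
  have : ∀ᶠ z in nhds x, ∀ m ∈ Finset.Icc (-N) N, z m = x m := by
    rw [Filter.eventually_all_finset]
    intro m _
    exact (continuous_apply m).continuousAt.eventually_mem
      ((isOpen_discrete ({x m} : Set A)).mem_nhds rfl)
  filter_upwards [this] with z hz m h1 h2
  exact hz m (Finset.mem_Icc.2 ⟨h1, h2⟩)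

theorem agree_of_mem_closure [DiscreteTopology A] {S : Set (ℤ → A)} {x : ℤ → A}
    (h : x ∈ closure S) (N : ℤ) : ∃ z ∈ S, ∀ m : ℤ, -N ≤ m → m ≤ N → z m = x m := by
  obtain ⟨z, h1, h2⟩ := mem_closure_iff_nhds.1 h _ (eventually_agree x N)
  exact ⟨z, h2, h1⟩

theorem mem_orbitClosure_iff [DiscreteTopology A] {x z : ℤ → A} :
    z ∈ orbitClosure x ↔ ∀ (i : ℤ) (n : ℕ), Occurs (window z i n) x := by
  constructor
  · intro h i n
    obtain ⟨_, ⟨k, rfl⟩, hk⟩ := agree_of_mem_closure h (|i| + n)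
    refine ⟨i + k, fun j hj => ?_⟩
    rw [length_window] at hj
    have h1 := le_abs_self i
    have h2 := neg_abs_le i
    have := hk (i + j) (by omega) (by omega)
    simp only [shift] at this
    rw [← occursAt_window z i n j (by simpa using hj), ← this]
    congr 1
    ring
  · intro h
    refine mem_closure_of_agree fun N => ?_
    obtain ⟨k, hk⟩ := h (-N) (2 * N + 1)
    refine ⟨_, ⟨k + N, rfl⟩, fun m h1 h2 => ?_⟩
    have e1 := hk (m + N).toNat (by rw [length_window]; omega)
    rw [← occursAt_window z (-N) (2 * N + 1) _ _] at e1
    simp only [shift]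
    convert e1 using 2 <;> omega

theorem mem_orbitClosure_self (x : ℤ → A) : x ∈ orbitClosure x :=
  subset_closure ⟨0, by simp⟩

theorem continuous_isImage [DiscreteTopology A] [TopologicalSpace B] {θ : A → List B}
    (hθ : ∀ a, θ a ≠ []) {f : (ℤ → A) → ℤ → B} (hf : ∀ x, IsImage θ x (f x)) :
    Continuous f := by
  refine continuous_pi fun n => continuous_iff_continuousAt.2 fun x => ?_
  refine ContinuousAt.congr (f := fun _ => f x n) continuousAt_const ?_
  filter_upwards [eventually_agree x |n|] with z hz
  exact ((hf z).eq_of_eqOn hθ (hf x) hz).symm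

end Topology

/-! ### The language of the Fibonacci system -/

section Language

theorem fib_ne_nil : ∀ a, fib a ≠ [] := by decide

theorem iter_fib_succ_zero (k : ℕ) :
    iter fib (k + 1) 0 = iter fib k 0 ++ iter fib k 1 := by
  rw [iter_succ]
  simp [fib]

theorem iter_fib_succ_one (k : ℕ) : iter fib (k + 1) 1 = iter fib k 0 := by
  rw [iter_succ]
  simp [fib]

theorem iter_fib_zero_prefix {j k : ℕ} (h : j ≤ k) : iter fib j 0 <+: iter fib k 0 := by
  induction k, h using Nat.le_induction with
  | base => exact List.prefix_rfl
  | succ k _ ih => exact ih.trans ⟨_, (iter_fib_succ_zero k).symm⟩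

theorem iter_fib_one_suffix {j k : ℕ} (h : j ≤ k) :
    iter fib (2 * j) 1 <:+ iter fib (2 * k) 1 := by
  induction k, h using Nat.le_induction with
  | base => exact List.suffix_rfl
  | succ k _ ih =>
    refine ih.trans ⟨iter fib (2 * k) 0, ?_⟩
    rw [Nat.mul_succ, iter_fib_succ_one, iter_fib_succ_zero]

theorem lt_length_iter_fib_zero (k : ℕ) : k < (iter fib k 0).length := by
  induction k with
  | zero => simp
  | succ k ih =>
    have := List.length_pos_of_ne_nil (iter_ne_nil fib_ne_nil k 1)
    rw [iter_fib_succ_zero, List.length_append]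
    omega

theorem lt_length_iter_fib_one (k : ℕ) : k < (iter fib (2 * k) 1).length := by
  cases k with
  | zero => simp
  | succ k =>
    rw [Nat.mul_succ, iter_fib_succ_one]
    have := lt_length_iter_fib_zero (2 * k + 1)
    omega

theorem getElem_eq_of_prefix_of_prefix {A : Type*} {u v w : List A} (hu : u <+: w) (hv : v <+: w)
    {n : ℕ} (h : n < u.length) (h' : n < v.length) : u[n] = v[n] := by
  obtain ⟨s, rfl⟩ := hu
  obtain ⟨t, ht⟩ := hv
  calc u[n] = (u ++ s)[n]'(by rw [List.length_append]; omega) :=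
        (List.getElem_append_left h).symm
    _ = (v ++ t)[n]'(by rw [List.length_append]; omega) := by simp only [ht]
    _ = v[n] := List.getElem_append_left h'

theorem occursAt_fibPoint_zero (k : ℕ) : OccursAt (iter fib k 0) fibPoint 0 := by
  intro j hj
  have hlt : j < (iter fib (j + 1) 0).length := by
    have := lt_length_iter_fib_zero (j + 1)
    omega
  rw [zero_add]
  change (iter fib (j + 1) 0).getD j 0 = _
  rw [List.getD_eq_getElem _ _ hlt]
  exact getElem_eq_of_prefix_of_prefix (iter_fib_zero_prefix (le_max_left _ k))
    (iter_fib_zero_prefix (le_max_right (j + 1) _)) _ _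

theorem occursAt_fibPoint_neg (k : ℕ) :
    OccursAt (iter fib (2 * k) 1) fibPoint (-(iter fib (2 * k) 1).length) := by
  intro j hj
  obtain ⟨n, hn⟩ : ∃ n : ℕ, n = (iter fib (2 * k) 1).length - 1 - j := ⟨_, rfl⟩
  have hlt : n < (iter fib (2 * (n + 1)) 1).reverse.length := by
    have := lt_length_iter_fib_one (n + 1)
    rw [List.length_reverse]
    omega
  rw [show -((iter fib (2 * k) 1).length : ℤ) + j = Int.negSucc n by omega]
  change (iter fib (2 * (n + 1)) 1).reverse.getD n 0 = _
  rw [List.getD_eq_getElem _ _ hlt]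
  have := getElem_eq_of_prefix_of_prefix
    (List.reverse_prefix.2 (iter_fib_one_suffix (le_max_left (n + 1) k)))
    (List.reverse_prefix.2 (iter_fib_one_suffix (le_max_right (n + 1) k))) hlt
    (show n < (iter fib (2 * k) 1).reverse.length by rw [List.length_reverse]; omega)
  rw [this, List.getElem_reverse]
  congr 1
  omega

theorem window_fibPoint_infix (i : ℤ) (n : ℕ) : ∃ k, window fibPoint i n <:+: iter fib k 0 := by
  obtain ⟨k, hk⟩ : ∃ k : ℕ, k = i.natAbs + n := ⟨_, rfl⟩
  have h1 := occursAt_fibPoint_neg k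
  have h2 : OccursAt (iter fib (2 * k) 1 ++ iter fib (2 * k) 0) fibPoint
      (-(iter fib (2 * k) 1).length) :=
    occursAt_append.2 ⟨h1, by simpa using occursAt_fibPoint_zero (2 * k)⟩
  refine ⟨2 * k + 2, ?_⟩
  rw [iter_add]
  -- The window straddles the dot inside `fib^(2k)(10)`, and 10 is a factor of `fib²(0) = 010`.
  refine List.IsInfix.trans ?_ 
    (infix_flatMap _ (show [1, 0] <:+: iter fib 2 0 from ⟨[0], [], by decide⟩))
  simp only [List.flatMap_cons, List.flatMap_nil, List.append_nil]
  rw [h2.eq_window, List.length_append]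
  have := lt_length_iter_fib_one k
  have := lt_length_iter_fib_zero (2 * k)
  exact window_infix_window _ (by omega) (by push_cast; omega)

theorem mem_fibSystem_iff {x : ℤ → Fin 2} :
    x ∈ fibSystem ↔ ∀ (i : ℤ) (n : ℕ), ∃ k, window x i n <:+: iter fib k 0 := by
  rw [fibSystem, mem_orbitClosure_iff]
  refine forall₂_congr fun i n => ⟨?_, ?_⟩
  · rintro ⟨j, h⟩
    rw [OccursAt.eq_window h]
    exact window_fibPoint_infix _ _
  · rintro ⟨k, h⟩
    exact (occursAt_fibPoint_zero k).occurs.of_infix h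

theorem isClosed_fibSystem : IsClosed fibSystem := isClosed_closure

theorem isCompact_fibSystem : IsCompact fibSystem := isClosed_fibSystem.isCompact

theorem fibPoint_mem_fibSystem : fibPoint ∈ fibSystem := mem_orbitClosure_self _

theorem shift_mem_fibSystem {x : ℤ → Fin 2} (h : x ∈ fibSystem) (k : ℤ) :
    shift k x ∈ fibSystem := by
  rw [mem_fibSystem_iff] at h ⊢
  intro i n
  obtain ⟨j, hj⟩ := h (i + k) n
  refine ⟨j, ?_⟩
  convert hj using 1
  exact (occursAt_shift.1 (occursAt_window (shift k x) i n)).eq_of_length_eq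
    (occursAt_window _ _ _) (by simp)

theorem image_mem_fibSystem {x y : ℤ → Fin 2} (hx : x ∈ fibSystem) (h : IsImage fib x y) :
    y ∈ fibSystem := by
  rw [mem_fibSystem_iff] at hx ⊢
  intro i n
  obtain ⟨j, m, hjm⟩ := h.window_infix fib_ne_nil i n
  obtain ⟨k, hk⟩ := hx j m
  refine ⟨k + 1, hjm.trans ?_⟩
  rw [iter_succ']
  exact infix_flatMap _ hk

/-- A compactness argument: `fib`-images and their shifts by 1 form a closed set, and every central
window of `x` is met by a shift of the image of `fibPoint`. Offsets 0 and 1 suffice because blocks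
have length at most 2. -/
theorem exists_preimage {x : ℤ → Fin 2} (hx : x ∈ fibSystem) :
    ∃ x' ∈ fibSystem, ∃ z, IsImage fib x' z ∧ ∃ k, x = shift k z := by
  choose f hf using exists_isImage fib_ne_nil
  have hcont := continuous_isImage fib_ne_nil hf
  have hZ : IsClosed (f '' fibSystem ∪ (fun x => shift 1 (f x)) '' fibSystem) :=
    ((isCompact_fibSystem.image hcont).union
      (isCompact_fibSystem.image ((continuous_shift 1).comp hcont))).isClosed
  have hmem : x ∈ f '' fibSystem ∪ (fun x => shift 1 (f x)) '' fibSystem := by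
    rw [← hZ.closure_eq]
    refine mem_closure_of_agree fun N => ?_
    obtain ⟨k, hk⟩ := mem_fibSystem_iff.1 hx (-N) (2 * N + 1)
    have hk' : window x (-N) (2 * N + 1) <:+: (iter fib k 0).flatMap fib := by
      rw [← iter_succ']
      exact hk.trans (iter_fib_zero_prefix k.le_succ).isInfix
    obtain ⟨i, hi⟩ := ((hf fibPoint).occurs_flatMap
      (occursAt_fibPoint_zero k).occurs).of_infix hk'
    have hagree (m : ℤ) (h1 : -N ≤ m) (h2 : m ≤ N) : shift (i + N) (f fibPoint) m = x m := by
      have e1 := hi (m + N).toNat (by rw [length_window]; omega)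
      rw [← occursAt_window x (-N) (2 * N + 1) _ _] at e1
      simp only [shift]
      convert e1 using 2 <;> omega
    obtain ⟨c, -, hc⟩ := isImage_iff.1 (hf fibPoint)
    obtain ⟨n, hn, hn'⟩ := exists_between_cuts (hc.strictMono fib_ne_nil) (i + N)
    have hfn : f (shift n fibPoint) = shift (c n) (f fibPoint) :=
      (hf _).unique fib_ne_nil (hc.isImage_shift n)
    have hlen : ∀ a, (fib a).length ≤ 2 := by decide
    have := hlen (fibPoint n)
    have := (hc n).1
    refine ⟨_, ?_, hagree⟩
    obtain h | h : i + N = 0 + c n ∨ i + N = 1 + c n := by omega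
    · exact Or.inl ⟨_, shift_mem_fibSystem fibPoint_mem_fibSystem n, by rw [hfn, h, zero_add]⟩
    · exact Or.inr ⟨_, shift_mem_fibSystem fibPoint_mem_fibSystem n, by
        simp only [hfn, h, shift_shift]⟩
  obtain ⟨x', hx', rfl⟩ | ⟨x', hx', rfl⟩ := hmem
  · exact ⟨x', hx', _, hf x', 0, by simp⟩
  · exact ⟨x', hx', _, hf x', 1, rfl⟩

end Language

/-! ### Desubstitution; forbidden and unavoidable words -/

section Desubstitution

theorem exists_cutBy {x : ℤ → Fin 2} (hx : x ∈ fibSystem) :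
    ∃ x' ∈ fibSystem, ∃ c, CutBy fib x' x c := by
  obtain ⟨x', hx', z, hz, k, rfl⟩ := exists_preimage hx
  obtain ⟨c, -, hc⟩ := isImage_iff.1 hz
  refine ⟨x', hx', fun n => c n - k, fun n => ⟨?_, ?_⟩⟩
  · simp only [(hc n).1]
    ring
  · rw [occursAt_shift, sub_add_cancel]
    exact (hc n).2

variable {x z : ℤ → Fin 2} {c : ℤ → ℤ}

theorem CutBy.fib_of_zero (h : CutBy fib x z c) {n : ℤ} (hn : x n = 0) :
    c (n + 1) = c n + 2 ∧ z (c n + 1) = 1 := by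
  have := h n
  simp only [hn, fib, Matrix.cons_val_zero, occursAt_cons] at this
  exact ⟨this.1, this.2.2.1⟩

theorem CutBy.fib_of_one (h : CutBy fib x z c) {n : ℤ} (hn : x n = 1) :
    c (n + 1) = c n + 1 := by
  have := h n
  simp only [hn, fib, Matrix.cons_val_one] at this
  exact this.1

theorem CutBy.fib_cut (h : CutBy fib x z c) (n : ℤ) : z (c n) = 0 := by
  have h2 := (h n).2
  obtain h0 | h0 : x n = 0 ∨ x n = 1 := by omega
  · rw [h0] at h2
    exact (occursAt_cons.1 h2).1
  · rw [h0] at h2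
    exact (occursAt_cons.1 h2).1

theorem CutBy.fib_of_next_zero (h : CutBy fib x z c) {n : ℤ} (hn : z (c n + 1) = 0) :
    x n = 1 := by
  by_contra h1
  have := (h.fib_of_zero (n := n) (by omega)).2
  omega

theorem CutBy.fib_of_next_one (h : CutBy fib x z c) {n : ℤ} (hn : z (c n + 1) = 1) :
    x n = 0 := by
  by_contra h1
  have := h.fib_of_one (n := n) (by omega)
  have := h.fib_cut (n + 1)
  simp_all

theorem CutBy.exists_cut (h : CutBy fib x z c) {m : ℤ} (hm : z m = 0) : ∃ n, c n = m := by
  obtain ⟨n, h1, h2⟩ := exists_between_cuts (h.strictMono fib_ne_nil) m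
  refine ⟨n, ?_⟩
  by_contra hne
  obtain h0 | h0 : x n = 0 ∨ x n = 1 := by omega
  · obtain ⟨h3, h4⟩ := h.fib_of_zero h0
    rw [show c n + 1 = m by omega] at h4
    omega
  · have := h.fib_of_one h0
    omega

theorem exists_flatMap_fib_append_zero (u : List (Fin 2)) :
    ∃ t, u.flatMap fib ++ [0] = 0 :: t := by
  cases u with
  | nil => exact ⟨[], rfl⟩
  | cons a u => fin_cases a <;> simp [fib]

/-- After a cut, the next letter tells the block 01 (next letter 1) from the block 0 (next letter 0,
the start of a block). The appended 0 makes the last block decodable as well. -/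
theorem CutBy.occursAt_of_flatMap_fib (h : CutBy fib x z c) {u : List (Fin 2)} {n : ℤ}
    (hu : OccursAt (u.flatMap fib ++ [0]) z (c n)) : OccursAt u x n := by
  induction u generalizing n with
  | nil => simp
  | cons a u ih =>
    obtain rfl | rfl : a = 0 ∨ a = 1 := by omega
    · have h1 : z (c n + 1) = 1 := by
        simp only [List.flatMap_cons, fib, Matrix.cons_val_zero, List.cons_append,
          occursAt_cons] at hu
        exact hu.2.1
      have h2 := h.fib_of_next_one h1
      refine occursAt_cons.2 ⟨h2, ih ?_⟩
      rw [List.flatMap_cons, List.append_assoc, occursAt_append] at hu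
      rw [(h.fib_of_zero h2).1]
      exact hu.2
    · rw [List.flatMap_cons, List.append_assoc, occursAt_append] at hu
      have h1 : z (c n + 1) = 0 := by
        obtain ⟨t, ht⟩ := exists_flatMap_fib_append_zero u
        rw [ht] at hu
        exact (occursAt_cons.1 hu.2).1
      have h2 := h.fib_of_next_zero h1
      refine occursAt_cons.2 ⟨h2, ih ?_⟩
      rw [h.fib_of_one h2]
      exact hu.2

/-- This generates the chain of forbidden words 11, 000, 0101010, then, after stripping the outer
0's that always flank a 1, 10101, 00100100 and 010100101001010. -/
theorem not_occurs_flatMap_fib {u : List (Fin 2)} (h : ∀ x ∈ fibSystem, ¬ Occurs u x) :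
    ∀ x ∈ fibSystem, ¬ Occurs (u.flatMap fib ++ [0]) x := by
  rintro x hx ⟨i, hi⟩
  obtain ⟨x', hx', c, hc⟩ := exists_cutBy hx
  obtain ⟨n, rfl⟩ : ∃ n, c n = i := hc.exists_cut (by
    obtain ⟨t, ht⟩ := exists_flatMap_fib_append_zero u
    have hi' : OccursAt (u.flatMap fib ++ [0]) x i := hi
    rw [ht] at hi'
    exact (occursAt_cons.1 hi').1)
  exact h x' hx' (hc.occursAt_of_flatMap_fib hi).occurs

theorem occurs_flatMap_fib {u : List (Fin 2)} (h : ∀ x ∈ fibSystem, Occurs u x) :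
    ∀ x ∈ fibSystem, Occurs (u.flatMap fib ++ [0]) x := by
  intro x hx
  obtain ⟨x', hx', c, hc⟩ := exists_cutBy hx
  obtain ⟨n, hn⟩ := h x' hx'
  obtain ⟨h1, h2⟩ := hc.occursAt_flatMap hn
  refine (occursAt_append.2 ⟨h1, ?_⟩ : OccursAt _ _ (c n)).occurs
  rw [← h2]
  simp [hc.fib_cut]

theorem not_occurs_one_one : ∀ x ∈ fibSystem, ¬ Occurs [1, 1] x := by
  rintro x hx ⟨i, hi⟩
  obtain ⟨h1, h2, -⟩ : x i = 1 ∧ x (i + 1) = 1 ∧ True := by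
    have : OccursAt [1, 1] x i := hi
    simpa using this
  obtain ⟨x', hx', c, hc⟩ := exists_cutBy hx
  obtain ⟨n, h3, h4⟩ := exists_between_cuts (hc.strictMono fib_ne_nil) i
  have hn := hc.fib_cut n
  have hn' := hc.fib_cut (n + 1)
  have hlen : c (n + 1) = c n + 1 ∨ c (n + 1) = c n + 2 := by
    obtain h0 | h0 : x' n = 0 ∨ x' n = 1 := by omega
    · exact Or.inr (hc.fib_of_zero h0).1
    · exact Or.inl (hc.fib_of_one h0)
  obtain h | h : i = c n ∨ i + 1 = c (n + 1) := by omega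
  · rw [h] at h1
    omega
  · rw [h] at h2
    omega

theorem eq_zero_of_eq_one (hx : x ∈ fibSystem) {n m : ℤ} (hm : m = n + 1) (h : x n = 1) :
    x m = 0 := by
  subst hm
  by_contra h1
  exact not_occurs_one_one x hx (OccursAt.occurs (i := n) (by simp; omega))

theorem eq_zero_of_next_eq_one (hx : x ∈ fibSystem) {n m : ℤ} (hm : n = m + 1) (h : x n = 1) :
    x m = 0 := by
  by_contra h1
  have := eq_zero_of_eq_one hx hm (by omega)
  omega

theorem not_occurs_zero_zero_zero : ∀ x ∈ fibSystem, ¬ Occurs [0, 0, 0] x :=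
  not_occurs_flatMap_fib not_occurs_one_one

theorem eq_one_of_eq_zero_of_eq_zero (hx : x ∈ fibSystem) {n : ℤ} (h : x n = 0)
    (h' : x (n + 1) = 0) : x (n + 2) = 1 := by
  by_contra h1
  refine not_occurs_zero_zero_zero x hx (OccursAt.occurs (i := n) ?_)
  simp only [occursAt_cons, occursAt_nil, and_true, add_assoc]
  exact ⟨h, h', by norm_num; omega⟩

theorem not_occurs_0101010 : ∀ x ∈ fibSystem, ¬ Occurs [0, 1, 0, 1, 0, 1, 0] x :=
  not_occurs_flatMap_fib not_occurs_zero_zero_zero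

theorem not_occurs_10101 : ∀ x ∈ fibSystem, ¬ Occurs [1, 0, 1, 0, 1] x := by
  rintro x hx ⟨i, hi⟩
  have hi' : OccursAt [1, 0, 1, 0, 1] x i := hi
  simp only [occursAt_cons, occursAt_nil, and_true] at hi'
  refine not_occurs_0101010 x hx (OccursAt.occurs (i := i - 1) ?_)
  simp only [occursAt_cons, occursAt_nil, and_true, sub_add_cancel]
  exact ⟨eq_zero_of_next_eq_one hx (by ring) hi'.1, hi'.1, hi'.2.1, hi'.2.2.1, hi'.2.2.2.1,
    hi'.2.2.2.2, eq_zero_of_eq_one hx rfl hi'.2.2.2.2⟩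

theorem not_occurs_00100100 : ∀ x ∈ fibSystem, ¬ Occurs [0, 0, 1, 0, 0, 1, 0, 0] x :=
  not_occurs_flatMap_fib not_occurs_10101

theorem not_occurs_01010010100101 :
    ∀ x ∈ fibSystem, ¬ Occurs [0, 1, 0, 1, 0, 0, 1, 0, 1, 0, 0, 1, 0, 1, 0] x :=
  not_occurs_flatMap_fib not_occurs_00100100

theorem occurs_zero : ∀ x ∈ fibSystem, Occurs [0] x := by
  intro x hx
  by_cases h : x 0 = 0
  · exact OccursAt.occurs (i := 0) (by simpa using h)
  · exact OccursAt.occurs (i := 1)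
      (by simpa using eq_zero_of_eq_one hx (n := 0) rfl (by omega))

theorem occurs_0010100100 : ∀ x ∈ fibSystem, Occurs [0, 0, 1, 0, 1, 0, 0, 1, 0, 0] x :=
  fun x hx => Occurs.of_infix (occurs_flatMap_fib (occurs_flatMap_fib
    (occurs_flatMap_fib (occurs_flatMap_fib occurs_zero))) x hx) (by decide)

end Desubstitution

/-! ### Weights, periods and the absence of fourth powers -/

section PowerFree

open Real
open scoped goldenRatio

/-- The weight of a letter: `fib` multiplies the weight of every word by the golden ratio. -/
noncomputable def weight (a : Fin 2) : ℝ := if a = 0 then φ else 1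

theorem weight_zero : weight 0 = φ := if_pos rfl

theorem weight_one : weight 1 = 1 := if_neg (by decide)

theorem one_le_weight (a : Fin 2) : 1 ≤ weight a := by
  unfold weight
  split_ifs
  · exact one_lt_goldenRatio.le
  · exact le_rfl

variable {x : ℤ → Fin 2} {S : ℤ → ℝ}

theorem le_sub_of_partial_sums (hS : ∀ n, S (n + 1) = S n + weight (x n)) {i j : ℤ}
    (hij : i ≤ j) : (j - i : ℝ) ≤ S j - S i := by
  induction j, hij using Int.leInduction with
  | base => simp
  | succ n _ ih =>
    have := hS n
    have := one_le_weight (x n)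
    push_cast
    linarith

theorem CutBy.partial_sums_eq {x' : ℤ → Fin 2} {c : ℤ → ℤ} (h : CutBy fib x' x c)
    (hS : ∀ n, S (n + 1) = S n + weight (x n)) {S' : ℤ → ℝ}
    (hS' : ∀ n, S' (n + 1) = S' n + weight (x' n)) {a b : ℤ} (hab : a ≤ b) :
    S (c b) - S (c a) = φ * (S' b - S' a) := by
  induction b, hab using Int.leInduction with
  | base => simp
  | succ n _ ih =>
    have h1 := hS (c n)
    have h2 := hS' n
    rw [h.fib_cut n, weight_zero] at h1
    obtain h0 | h0 : x' n = 0 ∨ x' n = 1 := by omega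
    · obtain ⟨h3, h4⟩ := h.fib_of_zero h0
      have h5 := hS (c n + 1)
      rw [h4, weight_one, add_assoc] at h5
      rw [h0, weight_zero] at h2
      rw [h3, h2]
      norm_num at h5
      rw [h5, h1]
      linear_combination ih - goldenRatio_sq
    · rw [h.fib_of_one h0, h1, h2, h0, weight_one]
      linear_combination ih

/-- A 1 is always preceded by 0, so if the word starts with 1 both that 1 and its translate by `p`
extend to the left by 0. This preserves the weight of a period and puts the start of the word at a
cut. -/
theorem exists_extend_left (hx : x ∈ fibSystem) (hS : ∀ n, S (n + 1) = S n + weight (x n))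
    {p i j : ℤ} (hij : i + p < j) (h : ∀ n, i ≤ n → n < j - p → x n = x (n + p)) :
    ∃ i' ≤ i, x i' = 0 ∧ (∀ n, i' ≤ n → n < j - p → x n = x (n + p)) ∧
      S (i' + p) - S i' = S (i + p) - S i ∧ S i' ≤ S i := by
  obtain h0 | h0 : x i = 0 ∨ x i = 1 := by omega
  · exact ⟨i, le_rfl, h0, h, rfl, le_rfl⟩
  · have h1 := eq_zero_of_next_eq_one hx (m := i - 1) (by ring) h0
    have h2 : x (i - 1 + p) = 0 :=
      eq_zero_of_next_eq_one hx (n := i + p) (by ring) (by rw [← h i le_rfl (by omega), h0])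
    have h3 := hS (i - 1)
    have h4 := hS (i - 1 + p)
    rw [h1, sub_add_cancel] at h3
    rw [h2, show i - 1 + p + 1 = i + p by ring] at h4
    refine ⟨i - 1, by omega, h1, fun n hn hn' => ?_, by linarith, ?_⟩
    · obtain rfl | hn := hn.eq_or_lt
      · rw [h1, h2]
      · exact h n (by omega) hn'
    · have := one_le_weight 0
      linarith

theorem exists_extend_right (hx : x ∈ fibSystem) (hS : ∀ n, S (n + 1) = S n + weight (x n))
    {p i j : ℤ} (hij : i + p < j) (h : ∀ n, i ≤ n → n < j - p → x n = x (n + p)) :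
    ∃ j' ≥ j, x (j' - 1) = 0 ∧ (∀ n, i ≤ n → n < j' - p → x n = x (n + p)) ∧ S j ≤ S j' := by
  obtain h0 | h0 : x (j - 1) = 0 ∨ x (j - 1) = 1 := by omega
  · exact ⟨j, le_rfl, h0, h, le_rfl⟩
  · have h1 := eq_zero_of_eq_one hx (m := j) (by ring) h0
    have h2 : x (j - p) = 0 := by
      refine eq_zero_of_eq_one hx (n := j - p - 1) (by ring) ?_
      rw [h (j - p - 1) (by omega) (by omega), ← h0]
      congr 1
      ring
    refine ⟨j + 1, by omega, by simpa using h1, fun n hn hn' => ?_, ?_⟩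
    · obtain rfl | hn' : n = j - p ∨ n < j - p := by omega
      · rw [h2, sub_add_cancel, h1]
      · exact h n hn hn'
    · have := one_le_weight (x j)
      linarith [hS j]

/-- A word with period `p` in the Fibonacci system has weight less than `2 + φ` times the weight
of its prefix of length `p`. -/
theorem weight_le_of_period (p : ℕ) : ∀ x ∈ fibSystem, ∀ S : ℤ → ℝ,
    (∀ n, S (n + 1) = S n + weight (x n)) → ∀ i j : ℤ, 0 < p → i + p ≤ j →
    (∀ n, i ≤ n → n < j - p → x n = x (n + p)) →
    S j - S i + φ ^ 2 ≤ (2 + φ) * (S (i + p) - S i) := by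
  induction p using Nat.strong_induction_on with
  | _ p ih =>
  intro x hx S hS i j hp hij h
  have hφ := one_lt_goldenRatio
  have hφ2 := goldenRatio_sq
  -- For a single period of weight `W` the claim is `φ² ≤ (1 + φ) W = φ² W`, and `W ≥ 1`.
  obtain rfl | hij := hij.eq_or_lt
  · have h1 := le_sub_of_partial_sums hS (show i ≤ i + p by omega)
    have h2 : (1 : ℝ) ≤ p := by exact_mod_cast hp
    push_cast at h1
    nlinarith
  obtain ⟨i', hi', hi0, h', hW, hSi⟩ := exists_extend_left hx hS hij h
  obtain ⟨j', hj', hj0, h'', hSj⟩ := exists_extend_right hx hS (show i' + p < j by omega) h'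
  suffices S j' - S i' + φ ^ 2 ≤ (2 + φ) * (S (i' + p) - S i') by
    rw [hW] at this
    linarith
  have hij' : i' + p < j' := by omega
  clear hW hSi hSj hij h h' hj' hi'
  rename' h'' => h, hij' => hij, i' => i0, j' => j0
  have hip : x (i0 + p) = 0 := by rw [← h i0 le_rfl (by omega), hi0]
  -- Period 1 leaves only the word 00, for which equality holds.
  obtain rfl | hp1 : p = 1 ∨ 2 ≤ p := by omega
  · push_cast at *
    have h1 := eq_one_of_eq_zero_of_eq_zero hx hi0 hip
    obtain rfl : j0 = i0 + 1 + 1 := by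
      by_contra hne
      have := h (i0 + 1) (by omega) (by omega)
      rw [hip, add_assoc, show (1 : ℤ) + 1 = 2 by rfl, h1] at this
      omega
    rw [hS, hS, hip, hi0, weight_zero]
    nlinarith
  obtain ⟨x', hx', c, hc⟩ := exists_cutBy hx
  have hmono := hc.strictMono fib_ne_nil
  obtain ⟨S', -, hS'⟩ := exists_partial_sums fun n => weight (x' n)
  obtain ⟨a, rfl⟩ := hc.exists_cut hi0
  obtain ⟨b, hb⟩ := hc.exists_cut hj0
  obtain ⟨d, hd⟩ := hc.exists_cut hip
  have had : a < d := hmono.lt_iff_lt.1 (by omega)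
  have hdb : d ≤ b := hmono.le_iff_le.1 (by omega)
  obtain ⟨q, rfl⟩ := Int.le.dest had.le
  -- The last letter is a 0 at the cut `c b`, so `c n + 1` is still within reach of the period, and
  -- the letter there determines `x' n`.
  have hstep (n : ℤ) (hn : n < b - q) (hn' : a ≤ n) (hcn : c (n + q) = c n + p) :
      x' n = x' (n + q) := by
    have h1 : c (n + q) < c b := hmono (by omega)
    have h2 := hmono.monotone hn'
    have h3 := h (c n + 1) (by omega) (by omega)
    rw [show c n + 1 + p = c (n + q) + 1 by omega] at h3
    obtain h0 | h0 : x' n = 0 ∨ x' n = 1 := by omega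
    · rw [h0, hc.fib_of_next_one (by rw [← h3, (hc.fib_of_zero h0).2])]
    · rw [h0, hc.fib_of_next_zero]
      rw [← h3, ← hc.fib_of_one h0, hc.fib_cut]
  have hcut (n : ℤ) (hn' : a ≤ n) : n ≤ b - q → c (n + q) = c n + p := by
    induction n, hn' using Int.leInduction with
    | base => exact fun _ => hd
    | succ n hn' ih =>
      intro hn
      have h1 := ih (by omega)
      have h2 := (hc n).1
      have h3 := (hc (n + q)).1
      rw [← hstep n (by omega) hn' h1] at h3
      rw [show n + 1 + (q : ℤ) = n + q + 1 by ring]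
      omega
  -- As 11 does not occur in `x'`, one of any two consecutive blocks has length 2, so `q ≥ 2` blocks
  -- are longer than `q`.
  have hqp : q < p := by
    by_contra! hle
    have h1 := add_le_of_strictMono hmono (show a + 2 ≤ a + q by omega)
    have h3 := hmono (show a < a + 1 by omega)
    have h4 := hmono (show a + 1 < a + 1 + 1 by omega)
    rw [add_assoc] at h4
    norm_num at h4
    obtain h0 | h0 : x' a = 0 ∨ x' a = 1 := by omega
    · have := (hc.fib_of_zero h0).1
      omega
    · have := (hc.fib_of_zero (eq_zero_of_eq_one hx' rfl h0)).1
      rw [add_assoc] at this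
      norm_num at this
      omega
  have hmain := ih q hqp x' hx' S' hS' a b (by omega) hdb
    fun n h1 h2 => hstep n h2 h1 (hcut n h1 h2.le)
  have e1 := hc.partial_sums_eq hS hS' (show a ≤ b by omega)
  have e2 := hc.partial_sums_eq hS hS' (show a ≤ a + q by omega)
  have e3 := hS (j0 - 1)
  rw [hj0, weight_zero, sub_add_cancel] at e3
  rw [hb] at e1
  rw [hd] at e2
  rw [e2, e3]
  -- Multiplying the induction hypothesis by φ turns `φ²` into `φ³ = φ² + φ`, which pays for the
  -- last 0 of weight φ left outside the blocks.
  nlinarith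

theorem not_fourth_power (hx : x ∈ fibSystem) {p : ℕ} (hp : 0 < p) (i : ℤ) :
    ¬ ∀ n, i ≤ n → n < i + 3 * p → x n = x (n + p) := by
  intro h
  obtain ⟨S, -, hS⟩ := exists_partial_sums fun n => weight (x n)
  have h1 := weight_le_of_period p x hx S hS i (i + 4 * p) hp (by omega)
    fun n h1 h2 => h n h1 (by omega)
  have hconst (n : ℤ) (hn : i ≤ n) : n ≤ i + 3 * p → S (n + p) - S n = S (i + p) - S i := by
    induction n, hn using Int.leInduction with
    | base => exact fun _ => rfl
    | succ n hn ih =>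
      intro hn'
      have h2 := hS n
      have h3 := hS (n + p)
      rw [← h n hn (by omega), show n + (p : ℤ) + 1 = n + 1 + p by ring] at h3
      linarith [ih (by omega)]
  have h2 := hconst (i + p) (by omega) (by omega)
  have h3 := hconst (i + 2 * p) (by omega) (by omega)
  have h4 := hconst (i + 3 * p) (by omega) (by omega)
  rw [show i + (p : ℤ) + p = i + 2 * p by ring] at h2
  rw [show i + 2 * (p : ℤ) + p = i + 3 * p by ring] at h3
  rw [show i + 3 * (p : ℤ) + p = i + 4 * p by ring] at h4
  have h5 := le_sub_of_partial_sums hS (show i ≤ i + p by omega)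
  have h6 : (1 : ℝ) ≤ p := by exact_mod_cast hp
  push_cast at h5
  have := goldenRatio_lt_two
  have := goldenRatio_pos
  nlinarith

end PowerFree

/-! ### The doubled system: shape, conjugacy, local structure, fourth powers -/

section Doubled

/-- The block map from the Fibonacci system to its doubled system. -/
def code (x : ℤ → Fin 2) (n : ℤ) : Fin 2 := letterMap (blockCode (x n) (x (n + 1)))

theorem doubledSystem_eq : doubledSystem = code '' fibSystem := by
  rw [doubledSystem, twoBlockSystem, Set.image_image]
  rfl

theorem code_eq_one_iff {x : ℤ → Fin 2} {n : ℤ} : code x n = 1 ↔ x n = 0 ∧ x (n + 1) = 0 := by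
  unfold code
  generalize x n = a
  generalize x (n + 1) = b
  revert a b
  decide

theorem code_shift (k : ℤ) (x : ℤ → Fin 2) : code (shift k x) = shift k (code x) := by
  funext n
  simp only [code, shift]
  rw [add_right_comm]

theorem continuous_code : Continuous code := by
  refine continuous_pi fun n => ?_
  have h : Continuous fun p : Fin 2 × Fin 2 => letterMap (blockCode p.1 p.2) :=
    continuous_of_discreteTopology
  have h' : Continuous fun x : ℤ → Fin 2 => (x n, x (n + 1)) := by fun_prop
  exact h.comp h'

theorem CutBy.code {x z : ℤ → Fin 2} {c : ℤ → ℤ} (h : CutBy fib x z c) :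
    CutBy double x (code z) c := by
  intro n
  have h1 := h.fib_cut n
  have h2 := h.fib_cut (n + 1)
  obtain h0 | h0 : x n = 0 ∨ x n = 1 := by omega
  · obtain ⟨h3, h4⟩ := h.fib_of_zero h0
    rw [h0]
    refine ⟨h3, ?_⟩
    have h5 := @code_eq_one_iff z (c n)
    have h6 := @code_eq_one_iff z (c n + 1)
    simp only [double, Matrix.cons_val_zero, occursAt_cons, occursAt_nil, and_true]
    rw [h4] at h5 h6
    constructor <;> omega
  · have h3 := h.fib_of_one h0
    rw [h0]
    refine ⟨h3, ?_⟩
    rw [h3] at h2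
    simpa [double] using code_eq_one_iff.2 ⟨h1, h2⟩

theorem double_ne_nil : ∀ a, double a ≠ [] := by decide

theorem doubledSystem_eq_shifts : doubledSystem =
    {y : ℤ → Fin 2 | ∃ x ∈ fibSystem, ∃ z : ℤ → Fin 2,
      IsImage double x z ∧ ∃ k : ℤ, y = shift k z} := by
  rw [doubledSystem_eq]
  ext y
  constructor
  · rintro ⟨_, hx, rfl⟩
    obtain ⟨x', hx', z, hz, k, rfl⟩ := exists_preimage hx
    obtain ⟨c, h0, hc⟩ := isImage_iff.1 hz
    exact ⟨x', hx', code z, ⟨c, h0, hc.code⟩, k, code_shift k z⟩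
  · rintro ⟨x, hx, z, hz, k, rfl⟩
    obtain ⟨w, hw⟩ := exists_isImage fib_ne_nil x
    obtain ⟨c, h0, hc⟩ := isImage_iff.1 hw
    refine ⟨shift k w, shift_mem_fibSystem (image_mem_fibSystem hx hw) k, ?_⟩
    rw [code_shift, hz.unique double_ne_nil (isImage_iff.2 ⟨c, h0, hc.code⟩)]

theorem code_eq_zero_iff {x : ℤ → Fin 2} (hx : x ∈ fibSystem) {n : ℤ} :
    code x n = 0 ↔ x (n + 1) ≠ x n := by
  have h1 := @code_eq_one_iff x n
  have h2 := @eq_zero_of_eq_one x hx n _ rfl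
  omega

theorem eq_iff_of_code_eq {x x' : ℤ → Fin 2} (hx : x ∈ fibSystem) (hx' : x' ∈ fibSystem) {n : ℤ}
    (h : code x n = code x' n) : x n = x' n ↔ x (n + 1) = x' (n + 1) := by
  have h1 := @code_eq_zero_iff x hx n
  have h2 := @code_eq_zero_iff x' hx' n
  rw [h] at h1
  omega

/-- The values of `code` on an interval and one letter `0` determine the sequence there. -/
theorem eq_of_code_eq {x x' : ℤ → Fin 2} (hx : x ∈ fibSystem) (hx' : x' ∈ fibSystem) {a b m : ℤ}
    (h : ∀ n, a ≤ n → n < b → code x n = code x' n) (ham : a ≤ m) (hmb : m < b)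
    (hm : code x m = 1) (n : ℤ) : a ≤ n → n ≤ b → x n = x' n := by
  have h0 : x m = x' m := by
    rw [(code_eq_one_iff.1 hm).1, (code_eq_one_iff.1 ((h m ham hmb).symm.trans hm)).1]
  induction n using Int.inductionOn' (b := m) with
  | zero => exact fun _ _ => h0
  | succ k hk ih =>
    exact fun h1 h2 => (eq_iff_of_code_eq hx hx' (h k (by omega) (by omega))).1
      (ih (by omega) (by omega))
  | pred k hk ih =>
    intro h1 h2
    refine (eq_iff_of_code_eq hx hx' (h (k - 1) (by omega) (by omega))).2 ?_
    rw [sub_add_cancel]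
    exact ih (by omega) (by omega)

theorem occurs_code {x : ℤ → Fin 2} (hx : x ∈ fibSystem) :
    Occurs [1, 0, 0, 0, 0, 1, 0, 0, 1] (code x) := by
  obtain ⟨i, hi⟩ := occurs_0010100100 x hx
  have hi' : OccursAt [0, 0, 1, 0, 1, 0, 0, 1, 0, 0] x i := hi
  refine OccursAt.occurs (i := i) ?_
  have h (n : ℤ) : code x n = if x n = 0 ∧ x (n + 1) = 0 then 1 else 0 := by
    split_ifs with h1
    · exact code_eq_one_iff.2 h1
    · have := @code_eq_one_iff x n
      omega
  simp only [occursAt_cons, occursAt_nil, and_true] at hi' ⊢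
  simp [h, hi']

theorem code_injOn : Set.InjOn code fibSystem := by
  intro x hx x' hx' h
  obtain ⟨i, hi⟩ := occurs_code hx
  have hi' : code x i = 1 := by simpa using hi 0 (by simp)
  funext n
  exact eq_of_code_eq hx hx' (a := min i n) (b := max i n + 1) (fun _ _ _ => congrFun h _)
    (by omega) (by omega) hi' n (by omega) (by omega)

theorem conjugate_fibSystem_doubledSystem : Conjugate fibSystem doubledSystem := by
  rw [doubledSystem_eq]
  have : CompactSpace fibSystem := isCompact_iff_compactSpace.1 isCompact_fibSystem
  have hcont : Continuous (Equiv.Set.imageOfInjOn code fibSystem code_injOn) :=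
    (continuous_code.comp continuous_subtype_val).subtype_mk _
  exact ⟨hcont.homeoOfEquivCompactToT2, fun x =>
    ⟨shift_mem_fibSystem x.2 1, code_shift 1 x⟩⟩

variable {y : ℤ → Fin 2}

theorem occurs_100001001 (hy : y ∈ doubledSystem) : Occurs [1, 0, 0, 0, 0, 1, 0, 0, 1] y := by
  rw [doubledSystem_eq] at hy
  obtain ⟨x, hx, rfl⟩ := hy
  exact occurs_code hx

/-- A run of zeros in the doubled system comes from an alternating word. -/
theorem alternate {x : ℤ → Fin 2} (hx : x ∈ fibSystem) {n m : ℤ} (hm : m = n + 1)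
    (h : code x n = 0) : (x n = 0 → x m = 1) ∧ (x n = 1 → x m = 0) ∧ (x m = 0 → x n = 1) ∧
      (x m = 1 → x n = 0) := by
  subst hm
  have := (code_eq_zero_iff hx).1 h
  omega

theorem doubled_not_occurs_00000 (hy : y ∈ doubledSystem) : ¬ Occurs [0, 0, 0, 0, 0] y := by
  rw [doubledSystem_eq] at hy
  obtain ⟨x, hx, rfl⟩ := hy
  rintro ⟨n, hn⟩
  have hn' : OccursAt [0, 0, 0, 0, 0] (code x) n := hn
  simp only [occursAt_cons, occursAt_nil, and_true] at hn'
  obtain ⟨h0, h1, h2, h3, h4⟩ := hn'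
  have a0 := alternate hx rfl h0
  have a1 := alternate hx rfl h1
  have a2 := alternate hx rfl h2
  have a3 := alternate hx rfl h3
  have a4 := alternate hx rfl h4
  -- Five coded 0's come from six alternating letters, which contain 10101 at offset 1 or 0.
  obtain h | h : x n = 0 ∨ x n = 1 := by omega
  · refine not_occurs_10101 x hx (OccursAt.occurs (i := n + 1) ?_)
    simp_all
  · refine not_occurs_10101 x hx (OccursAt.occurs (i := n) ?_)
    simp_all

theorem doubled_not_occurs_00001000010000 (hy : y ∈ doubledSystem) :
    ¬ Occurs [0, 0, 0, 0, 1, 0, 0, 0, 0, 1, 0, 0, 0, 0] y := by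
  rw [doubledSystem_eq] at hy
  obtain ⟨x, hx, rfl⟩ := hy
  rintro ⟨n, hn⟩
  have hn' : OccursAt [0, 0, 0, 0, 1, 0, 0, 0, 0, 1, 0, 0, 0, 0] (code x) n := hn
  simp only [occursAt_cons, occursAt_nil, and_true] at hn'
  obtain ⟨h0, h1, h2, h3, h4, h5, h6, h7, h8, h9, h10, h11, h12, h13⟩ := hn'
  rw [code_eq_one_iff] at h4 h9
  refine not_occurs_01010010100101 x hx (OccursAt.occurs (i := n) ?_)
  have e3 := (alternate hx rfl h3).2.2.1 h4.1
  have e2 := (alternate hx rfl h2).2.2.2 e3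
  have e1 := (alternate hx rfl h1).2.2.1 e2
  have e0 := (alternate hx rfl h0).2.2.2 e1
  have e6 := (alternate hx rfl h5).1 h4.2
  have e7 := (alternate hx rfl h6).2.1 e6
  have e8 := (alternate hx rfl h7).1 e7
  have e11 := (alternate hx rfl h10).1 h9.2
  have e12 := (alternate hx rfl h11).2.1 e11
  have e13 := (alternate hx rfl h12).1 e12
  have e14 := (alternate hx rfl h13).2.1 e13
  simp only [occursAt_cons, occursAt_nil, and_true]
  exact ⟨e0, e1, e2, e3, h4.1, h4.2, e6, e7, e8, h9.1, h9.2, e11, e12, e13, e14⟩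

theorem code_eq_zero_of_eq_one {x : ℤ → Fin 2} {n : ℤ} (h : x n = 1 ∨ x (n + 1) = 1) :
    code x n = 0 := by
  have := @code_eq_one_iff x n
  omega

/-- The word 1001 is the code of 00100. Avoiding 11, 000, 00100100 and 10101 forces 10100 to follow
it; `doubled_before_1001` is the mirror image. -/
theorem doubled_after_1001 (hy : y ∈ doubledSystem) {n : ℤ} (hn : OccursAt [1, 0, 0, 1] y n) :
    OccursAt [0, 0, 0, 0, 1] y (n + 4) := by
  rw [doubledSystem_eq] at hy
  obtain ⟨x, hx, rfl⟩ := hy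
  simp only [occursAt_cons, occursAt_nil, and_true, code_eq_one_iff, add_assoc] at hn ⊢
  norm_num at hn ⊢
  obtain ⟨⟨h0, h1⟩, h2, -, h3, h4⟩ := hn
  have e2 : x (n + 2) = 1 := (alternate hx (by ring) h2).1 h1
  have e5 : x (n + 5) = 1 := by
    have := eq_one_of_eq_zero_of_eq_zero hx h3 (by rw [← h4]; congr 1; ring)
    rwa [add_assoc] at this
  have e6 : x (n + 6) = 0 := eq_zero_of_eq_one hx (by ring) e5
  have e7 : x (n + 7) = 1 := by
    by_contra h
    refine not_occurs_00100100 x hx (OccursAt.occurs (i := n) ?_)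
    simp only [occursAt_cons, occursAt_nil, and_true, add_assoc]
    norm_num
    exact ⟨h0, h1, e2, h3, h4, e5, e6, by omega⟩
  have e8 : x (n + 8) = 0 := eq_zero_of_eq_one hx (by ring) e7
  have e9 : x (n + 9) = 0 := by
    by_contra h
    refine not_occurs_10101 x hx (OccursAt.occurs (i := n + 5) ?_)
    simp only [occursAt_cons, occursAt_nil, and_true, add_assoc]
    norm_num
    exact ⟨e5, e6, e7, e8, by omega⟩
  refine ⟨code_eq_zero_of_eq_one ?_, code_eq_zero_of_eq_one ?_, code_eq_zero_of_eq_one ?_,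
    code_eq_zero_of_eq_one ?_, e8, e9⟩ <;> simp only [add_assoc] <;> norm_num <;> simp [e5, e7]

theorem doubled_before_1001 (hy : y ∈ doubledSystem) {n : ℤ} (hn : OccursAt [1, 0, 0, 1] y n) :
    OccursAt [1, 0, 0, 0, 0] y (n - 5) := by
  rw [doubledSystem_eq] at hy
  obtain ⟨x, hx, rfl⟩ := hy
  obtain ⟨m, rfl⟩ : ∃ m, n = m + 5 := ⟨n - 5, by ring⟩
  simp only [occursAt_cons, occursAt_nil, and_true, code_eq_one_iff, add_assoc,
    add_sub_cancel_right] at hn ⊢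
  norm_num at hn ⊢
  obtain ⟨⟨h5, h6⟩, h7, -, h8, h9⟩ := hn
  have e7 : x (m + 7) = 1 := (alternate hx (by ring) h7).1 h6
  have e4 : x (m + 4) = 1 := by
    by_contra h
    have := eq_one_of_eq_zero_of_eq_zero hx (n := m + 4) (by omega)
      (by rw [← h5]; congr 1; ring)
    rw [add_assoc] at this
    norm_num at this
    omega
  have e3 : x (m + 3) = 0 := eq_zero_of_next_eq_one hx (by ring) e4
  have e2 : x (m + 2) = 1 := by
    by_contra h
    refine not_occurs_00100100 x hx (OccursAt.occurs (i := m + 2) ?_)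
    simp only [occursAt_cons, occursAt_nil, and_true, add_assoc]
    norm_num
    exact ⟨by omega, e3, e4, h5, h6, e7, h8, h9⟩
  have e1 : x (m + 1) = 0 := eq_zero_of_next_eq_one hx (by ring) e2
  have e0 : x m = 0 := by
    by_contra h
    refine not_occurs_10101 x hx (OccursAt.occurs (i := m) ?_)
    simp only [occursAt_cons, occursAt_nil, and_true, add_assoc]
    norm_num
    exact ⟨by omega, e1, e2, e3, e4⟩
  refine ⟨⟨e0, e1⟩, code_eq_zero_of_eq_one ?_, code_eq_zero_of_eq_one ?_,
    code_eq_zero_of_eq_one ?_, code_eq_zero_of_eq_one ?_⟩ <;> simp only [add_assoc] <;>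
    norm_num <;> simp [e2, e4]

theorem eq_of_occursAt_of_occursAt {A : Type*} {u : List A} {x : ℤ → A} {i k n : ℤ}
    (h : OccursAt u x i) (h' : OccursAt u x (i + k)) (h1 : i ≤ n) (h2 : n < i + u.length) :
    x n = x (n + k) := by
  have e1 := h (n - i).toNat (by omega)
  have e2 := h' (n - i).toNat (by omega)
  rw [← e1] at e2
  convert e2.symm using 2 <;> omega

theorem eq_of_fourth_power {A : Type*} {w : List A} {x : ℤ → A} {i n : ℤ}
    (h : OccursAt (w ++ w ++ w ++ w) x i) (h1 : i ≤ n) (h2 : n < i + 3 * w.length) :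
    x n = x (n + w.length) := by
  have h3 := (occursAt_append.1 h).1
  rw [List.append_assoc, List.append_assoc, ← List.append_assoc w w w, occursAt_append] at h
  refine eq_of_occursAt_of_occursAt h3 h.2 h1 ?_
  simp only [List.length_append]
  push_cast
  omega

theorem doubled_fourth_power_iff (hy : y ∈ doubledSystem) {w : List (Fin 2)} (hw : w ≠ []) :
    Occurs (w ++ w ++ w ++ w) y ↔ w = [0] := by
  constructor
  · rintro ⟨i, hi⟩
    have hi' : OccursAt (w ++ w ++ w ++ w) y i := hi
    have hper (n : ℤ) := eq_of_fourth_power (n := n) hi'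
    have hlen := List.length_pos_of_ne_nil hw
    by_cases h1 : ∃ n, i ≤ n ∧ n < i + 3 * w.length ∧ y n = 1
    · exfalso
      obtain ⟨m, hm1, hm2, hm⟩ := h1
      rw [doubledSystem_eq] at hy
      obtain ⟨x, hx, rfl⟩ := hy
      -- The 1 at `m` anchors the reconstruction from the code, applied to `x` and its translate by
      -- the period: equal codes give equal letters.
      refine not_fourth_power hx hlen i fun n h1 h2 => ?_
      exact eq_of_code_eq hx (shift_mem_fibSystem hx w.length)
        (fun n h1 h2 => by rw [code_shift]; exact hper n h1 h2) hm1 hm2 hm n h1 h2.le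
    · push Not at h1
      have hz (n : ℤ) (h2 : i ≤ n) (h3 : n < i + 3 * w.length) : y n = 0 := by
        have := h1 n h2 h3
        omega
      match w, hlen with
      | [a], _ =>
        have := hz i le_rfl (by simp)
        simp only [List.cons_append, occursAt_cons] at hi'
        rw [← hi'.1, this]
      | a :: b :: w, _ =>
        exfalso
        refine doubled_not_occurs_00000 hy (OccursAt.occurs (i := i) ?_)
        simp only [List.length_cons] at hz
        push_cast at hz
        simp only [occursAt_cons, occursAt_nil, and_true]
        refine ⟨?_, ?_, ?_, ?_, ?_⟩ <;> exact hz _ (by omega) (by omega)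
  · rintro rfl
    exact (occurs_100001001 hy).of_infix (by decide)

end Doubled

/-! ### From bounded prefixes and suffixes to bounded factors -/

section FlatMap

variable {A B : Type*}

theorem length_flatMap_le {g : A → List B} {L : ℕ} {w : List A}
    (h : ∀ a ∈ w, (g a).length ≤ L) : (w.flatMap g).length ≤ w.length * L := by
  induction w with
  | nil => simp
  | cons a w ih =>
    have h1 := h a (by simp)
    have h2 := ih fun b hb => h b (by simp [hb])
    rw [List.flatMap_cons, List.length_append, List.length_cons, Nat.succ_mul]
    omega

theorem prefix_append_cases {u v w : List A} (h : u <+: v ++ w) :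
    u <+: v ∨ ∃ t, u = v ++ t ∧ t <+: w := by
  rcases List.prefix_or_prefix_of_prefix h (List.prefix_append v w) with h1 | ⟨t, rfl⟩
  · exact Or.inl h1
  · exact Or.inr ⟨t, rfl, (List.prefix_append_right_inj v).1 h⟩

variable {P : List B → Prop} {g : A → List B} {D : ℕ}

theorem length_le_of_prefix_flatMap (hP : ∀ u v, P v → u <:+: v → P u) {w : List A}
    (hD : ∀ c ∈ w, ∀ u, P u → u <+: g c → u.length ≤ D) {u : List B} (hu : P u)
    (h : u <+: w.flatMap g) : u.length ≤ w.length * D := by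
  induction w generalizing u with
  | nil => simp_all
  | cons c w ih =>
    rw [List.length_cons, Nat.succ_mul]
    rw [List.flatMap_cons] at h
    obtain h' | ⟨t, rfl, h'⟩ := prefix_append_cases h
    · have := hD c (by simp) u hu h'
      omega
    · have h1 := hD c (by simp) _ (hP _ _ hu (List.prefix_append _ _).isInfix) List.prefix_rfl
      have h2 := ih (fun c hc => hD c (by simp [hc]))
        (hP _ _ hu (List.suffix_append _ _).isInfix) h'
      rw [List.length_append]
      omega

theorem infix_or_length_le_of_infix_flatMap (hP : ∀ u v, P v → u <:+: v → P u)
    (hD : ∀ c u, P u → u <+: g c → u.length ≤ D) (hD' : ∀ c u, P u → u <:+ g c → u.length ≤ D)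
    {w : List A} {u : List B} (hu : P u) (h : u <:+: w.flatMap g) :
    (∃ c, u <:+: g c) ∨ u.length ≤ (w.length + 1) * D := by
  induction w with
  | nil => simp_all
  | cons c w ih =>
    rw [List.flatMap_cons, List.infix_append_iff] at h
    obtain h | h | ⟨s, t, rfl, hs, ht⟩ := h
    · exact Or.inl ⟨c, h⟩
    · refine (ih h).imp_right fun h => h.trans ?_
      exact Nat.mul_le_mul_right D (by simp)
    · right
      have h1 := hD' c s (hP _ _ hu (List.prefix_append _ _).isInfix) hs
      have h2 := length_le_of_prefix_flatMap hP (fun c _ => hD c)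
        (hP _ _ hu (List.suffix_append _ _).isInfix) ht
      rw [List.length_append, List.length_cons, Nat.succ_mul, Nat.succ_mul]
      omega

/-- If the words with property `P` that are prefixes or suffixes of some `η^j(c)` have bounded
length, then so have those that occur anywhere in some `η^j(c)`. -/
theorem exists_length_le_of_infix_iter {A : Type*} [Finite A] {η : A → List A}
    {P : List A → Prop} (hP : ∀ u v, P v → u <:+: v → P u)
    (hD : ∃ D, ∀ j c u, P u → u <+: iter η j c → u.length ≤ D)
    (hD' : ∃ D, ∀ j c u, P u → u <:+ iter η j c → u.length ≤ D) :
    ∃ D, ∀ j c u, P u → u <:+: iter η j c → u.length ≤ D := by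
  obtain ⟨D₁, hD₁⟩ := hD
  obtain ⟨D₂, hD₂⟩ := hD'
  obtain ⟨L, hL⟩ := (Set.finite_range fun c => (η c).length).bddAbove
  -- A factor of `η^(j+1)(c)` lies inside one block `η^j(b)`, or splits into a suffix of a block,
  -- whole blocks and a prefix of a block: at most `L + 1` bounded pieces. The 1 covers `j = 0`.
  refine ⟨max 1 ((L + 1) * max D₁ D₂), fun j => ?_⟩
  induction j with
  | zero =>
    intro c u _ h
    exact le_max_of_le_left (by simpa using h.length_le)
  | succ j ih =>
    intro c u hu h
    rw [iter_succ] at h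
    obtain ⟨c, h⟩ | h := infix_or_length_le_of_infix_flatMap hP
      (fun c u hu h => (hD₁ j c u hu h).trans (le_max_left D₁ D₂))
      (fun c u hu h => (hD₂ j c u hu h).trans (le_max_right D₁ D₂)) hu h
    · exact ih c u hu h
    · refine le_max_of_le_right (h.trans (Nat.mul_le_mul_right _ ?_))
      have : (η c).length ≤ L := hL ⟨c, rfl⟩
      omega

end FlatMap

/-! ### Words over letters fixed by a power of the substitution -/

section Frozen

variable {A : Type*} {F : Set A}

/-- The words over `F` without fifth powers. -/
def FifthPowerFree (F : Set A) (u : List A) : Prop :=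
  (∀ a ∈ u, a ∈ F) ∧ ∀ v : List A, v ≠ [] → ¬ v ++ v ++ v ++ v ++ v <:+: u

theorem FifthPowerFree.of_infix (u v : List A) (hv : FifthPowerFree F v) (h : u <:+: v) :
    FifthPowerFree F u :=
  ⟨fun a ha => hv.1 a (h.subset ha), fun w hw hwu => hv.2 w hw (hwu.trans h)⟩

theorem FifthPowerFree.reverse {u : List A} (hu : FifthPowerFree F u) :
    FifthPowerFree F u.reverse := by
  refine ⟨fun a ha => hu.1 a (List.mem_reverse.1 ha), fun v hv h => ?_⟩
  refine hu.2 v.reverse (by simpa using hv) ?_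
  rw [← List.reverse_infix]
  simpa using h

theorem iter_reverse (η : A → List A) (j : ℕ) (c : A) :
    iter (fun a => (η a).reverse) j c = (iter η j c).reverse := by
  induction j with
  | zero => rfl
  | succ j ih => rw [iter_succ', iter_succ', ih, List.flatMap_reverse]; simp [Function.comp_def]

theorem exists_idempotent_iterate [Finite A] (g : A → A) :
    ∃ M, 0 < M ∧ ∀ a, g^[M] (g^[M] a) = g^[M] a := by
  obtain ⟨i, j, hne, h⟩ := Finite.exists_ne_map_eq_of_infinite fun n : ℕ => g^[n]
  wlog hij : i < j generalizing i j
  · exact this j i hne.symm h.symm (by omega)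
  obtain ⟨p, rfl⟩ : ∃ p, j = i + p := ⟨j - i, by omega⟩
  have hp (n : ℕ) (hn : i ≤ n) : g^[n + p] = g^[n] := by
    obtain ⟨m, rfl⟩ := Nat.exists_eq_add_of_le hn
    rw [show i + m + p = m + (i + p) by ring, Function.iterate_add, ← h, ← Function.iterate_add,
      add_comm]
  have hmul (n m : ℕ) (hn : i ≤ n) : g^[n + m * p] = g^[n] := by
    induction m with
    | zero => simp
    | succ m ih => rw [Nat.succ_mul, ← add_assoc, hp _ (by omega), ih]
  refine ⟨(i + 1) * p, Nat.mul_pos (by omega) (by omega), fun a => ?_⟩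
  rw [← Function.iterate_add_apply, hmul]
  nlinarith

theorem flatMap_eq_self {ζ : A → List A} (hF : ∀ c ∈ F, ζ c = [c]) {w : List A}
    (hw : ∀ a ∈ w, a ∈ F) : w.flatMap ζ = w := by
  induction w with
  | nil => rfl
  | cons a w ih =>
    rw [List.flatMap_cons, hF a (hw a (by simp)), ih fun b hb => hw b (by simp [hb])]
    rfl

theorem iter_eq_self {ζ : A → List A} (hF : ∀ c ∈ F, ζ c = [c]) (q : ℕ) :
    ∀ c ∈ F, iter ζ q c = [c] := by
  intro c hc
  induction q with
  | zero => rfl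
  | succ q ih => rw [iter_succ', ih]; simp [hF c hc]

theorem exists_first_split {w : List A} {E : Set A} (h : ∃ a ∈ w, a ∉ E) :
    ∃ α d β, w = α ++ d :: β ∧ (∀ a ∈ α, a ∈ E) ∧ d ∉ E := by
  induction w with
  | nil => simp at h
  | cons a w ih =>
    by_cases ha : a ∈ E
    · obtain ⟨b, hb, hbE⟩ := h
      obtain ⟨α, d, β, rfl, h1, h2⟩ := ih ⟨b, by
        rcases List.mem_cons.1 hb with rfl | hb
        · exact absurd ha hbE
        · exact hb, hbE⟩
      exact ⟨a :: α, d, β, rfl, by simpa [ha] using h1, h2⟩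
    · exact ⟨[], a, w, rfl, by simp, ha⟩

/-- Some power of a substitution that fixes the letters in `F` maps the letters in a set `E`
to words over `F`, and all other letters to words whose first letter outside `E` is in turn the
first letter outside `E` of its own image. -/
theorem exists_power_split [Finite A] {ζ : A → List A} (hF : ∀ c ∈ F, ζ c = [c]) :
    ∃ N, 0 < N ∧ ∃ E : Set A, F ⊆ E ∧ (∀ c ∈ E, ∀ a ∈ iter ζ N c, a ∈ F) ∧
      ∀ c ∉ E, ∃ α d β, iter ζ N c = α ++ d :: β ∧ (∀ a ∈ α, a ∈ E) ∧ d ∉ E ∧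
        ∃ α' β', iter ζ N d = α' ++ d :: β' ∧ ∀ a ∈ α', a ∈ E := by
  have hmono (c : A) (i j : ℕ) (hij : i ≤ j) (h : ∀ a ∈ iter ζ i c, a ∈ F) :
      ∀ a ∈ iter ζ j c, a ∈ F := by
    obtain ⟨m, rfl⟩ := Nat.exists_eq_add_of_le hij
    rwa [add_comm, iter_add, flatMap_eq_self (iter_eq_self hF m) h]
  obtain ⟨T, hT0, hT⟩ : ∃ T, 0 < T ∧
      ∀ c, (∃ i, ∀ a ∈ iter ζ i c, a ∈ F) → ∀ a ∈ iter ζ T c, a ∈ F := by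
    have h (c : A) : ∃ T, (∃ i, ∀ a ∈ iter ζ i c, a ∈ F) → ∀ a ∈ iter ζ T c, a ∈ F := by
      by_cases h : ∃ i, ∀ a ∈ iter ζ i c, a ∈ F
      · exact ⟨h.choose, fun _ => h.choose_spec⟩
      · exact ⟨0, fun h' => absurd h' h⟩
    choose t ht using h
    obtain ⟨T, hT⟩ := (Set.finite_range t).bddAbove
    exact ⟨T + 1, by omega, fun c hc => hmono c (t c) _
      ((hT ⟨c, rfl⟩).trans (by omega)) (ht c hc)⟩
  -- `E` collects the letters whose iterated images eventually lie over `F`; by finiteness one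
  -- exponent `T` serves all of them.
  obtain ⟨E, hE⟩ : ∃ E : Set A, E = {c | ∀ a ∈ iter ζ T c, a ∈ F} := ⟨_, rfl⟩
  have hFE : F ⊆ E := by
    intro c hc
    rw [hE]
    change ∀ a ∈ iter ζ T c, a ∈ F
    rw [iter_eq_self hF T c hc]
    simpa using hc
  have hsplit (c : A) (hc : c ∉ E) :
      ∃ α d β, iter ζ T c = α ++ d :: β ∧ (∀ a ∈ α, a ∈ E) ∧ d ∉ E := by
    refine exists_first_split ?_
    by_contra! hall
    refine hc ?_
    rw [hE]
    refine hT c ⟨T + T, fun a ha => ?_⟩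
    rw [iter_add, List.mem_flatMap] at ha
    obtain ⟨b, hb, hab⟩ := ha
    have := hall b hb
    rw [hE] at this
    exact this a hab
  have hsplit' (c : A) : ∃ d, c ∉ E →
      ∃ α β, iter ζ T c = α ++ d :: β ∧ (∀ a ∈ α, a ∈ E) ∧ d ∉ E := by
    by_cases hc : c ∈ E
    · exact ⟨c, fun h => absurd hc h⟩
    · obtain ⟨α, d, β, h⟩ := hsplit c hc
      exact ⟨d, fun _ => ⟨α, β, h⟩⟩
  choose g hg using hsplit'
  have hEF (i : ℕ) (c : A) (hc : c ∈ E) : ∀ a ∈ iter (iter ζ T) (i + 1) c, a ∈ F := by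
    rw [hE] at hc
    rwa [iter_succ, flatMap_eq_self (iter_eq_self (iter_eq_self hF T) i) hc]
  have hEE (i : ℕ) (c : A) (hc : c ∈ E) : ∀ a ∈ iter (iter ζ T) i c, a ∈ E := by
    cases i with
    | zero => simpa using hc
    | succ i => exact fun a ha => hFE (hEF i c hc a ha)
  have hgi (i : ℕ) (c : A) (hc : c ∉ E) : ∃ α β,
      iter (iter ζ T) i c = α ++ g^[i] c :: β ∧ (∀ a ∈ α, a ∈ E) ∧ g^[i] c ∉ E := by
    induction i generalizing c with
    | zero => exact ⟨[], [], by simp, by simp, by simpa using hc⟩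
    | succ i ih =>
      obtain ⟨α, β, h1, h2, h3⟩ := hg c hc
      obtain ⟨α', β', h1', h2', h3'⟩ := ih (g c) h3
      refine ⟨α.flatMap (iter (iter ζ T) i) ++ α', β' ++ β.flatMap (iter (iter ζ T) i), ?_, ?_, h3'⟩
      · rw [iter_succ, h1, List.flatMap_append, List.flatMap_cons, h1']
        simp
      · intro a ha
        rcases List.mem_append.1 ha with ha | ha
        · obtain ⟨b, hb, hab⟩ := List.mem_flatMap.1 ha
          exact hEE i b (h2 b hb) a hab
        · exact h2' a ha
  -- Letters of `E` only produce letters of `E`, so the first letter outside `E` evolves by the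
  -- self-map `g`. An idempotent power of `g` makes it stationary.
  obtain ⟨M, hM0, hM⟩ := exists_idempotent_iterate g
  refine ⟨T * M, Nat.mul_pos hT0 hM0, E, hFE, fun c hc => ?_, fun c hc => ?_⟩
  · obtain ⟨m, rfl⟩ : ∃ m, M = m + 1 := ⟨M - 1, by omega⟩
    rw [← iter_iter]
    exact hEF m c hc
  · rw [← iter_iter]
    obtain ⟨α, β, h1, h2, h3⟩ := hgi M c hc
    obtain ⟨α', β', h1', h2', -⟩ := hgi M _ h3
    rw [hM] at h1'
    exact ⟨α, _, β, h1, h2, h3, α', β', h1', h2'⟩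

theorem iter_of_split {ζ : A → List A} {E : Set A} (hF : ∀ c ∈ F, ζ c = [c])
    (hE : ∀ c ∈ E, ∀ a ∈ ζ c, a ∈ F) {d : A} {α β : List A} (h : ζ d = α ++ d :: β)
    (hα : ∀ a ∈ α, a ∈ E) (q : ℕ) :
    ∃ γ, iter ζ (q + 1) d = (List.replicate q (α.flatMap ζ)).flatten ++ α ++ d :: γ := by
  induction q with
  | zero => exact ⟨β, by simp [h]⟩
  | succ q ih =>
    obtain ⟨γ, ih⟩ := ih
    have hv : ∀ a ∈ (List.replicate q (α.flatMap ζ)).flatten, a ∈ F := by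
      intro a ha
      obtain ⟨l, hl, hal⟩ := List.mem_flatten.1 ha
      rw [(List.mem_replicate.1 hl).2] at hal
      obtain ⟨b, hb, hab⟩ := List.mem_flatMap.1 hal
      exact hE b (hα b hb) a hab
    refine ⟨β ++ γ.flatMap ζ, ?_⟩
    rw [iter_succ', ih, List.flatMap_append, List.flatMap_append, flatMap_eq_self hF hv,
      List.flatMap_cons, h, List.replicate_succ']
    simp

/-- A word over `F` must stop before `d`, so by `iter_of_split` it is a prefix of `v^q α` with `v =
ζ(α)`. Beyond length `5|v| + |α|` it would start with `v^5`. -/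
theorem length_le_of_prefix_split {ζ : A → List A} {E : Set A} (hζ : ∀ a, ζ a ≠ [])
    (hF : ∀ c ∈ F, ζ c = [c]) (hE : ∀ c ∈ E, ∀ a ∈ ζ c, a ∈ F) {d : A} {α β : List A}
    (h : ζ d = α ++ d :: β) (hα : ∀ a ∈ α, a ∈ E) (hd : d ∉ F) (q : ℕ) {u : List A}
    (hu : FifthPowerFree F u) (hpre : u <+: iter ζ q d) :
    u.length ≤ 5 * (α.flatMap ζ).length + α.length := by
  have hnil {w γ : List A} (h : u <+: w ++ d :: γ) : u <+: w := by
    obtain h | ⟨t, rfl, ht⟩ := prefix_append_cases h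
    · exact h
    · cases t with
      | nil => simp
      | cons b t =>
        obtain ⟨s, hs⟩ := ht
        obtain ⟨rfl, -⟩ := List.cons_eq_cons.1 hs
        exact absurd (hu.1 b (by simp)) hd
  cases q with
  | zero =>
    have := hnil (w := []) (γ := []) (by simpa using hpre)
    simp_all
  | succ q =>
    obtain ⟨γ, hγ⟩ := iter_of_split hF hE h hα q
    rw [hγ] at hpre
    have hpre := hnil hpre
    by_cases hv : α.flatMap ζ = []
    · have hα0 : α = [] := by
        by_contra hne
        exact flatMap_ne_nil hζ hne hv
      simp_all
    by_contra! hlt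
    have hlen := hpre.length_le
    simp only [List.length_append, List.length_flatten, List.map_replicate, List.sum_replicate,
      smul_eq_mul] at hlen
    have hq : 5 ≤ q := by
      by_contra! hq
      have := Nat.mul_le_mul_right (α.flatMap ζ).length (show q ≤ 5 by omega)
      omega
    obtain ⟨r, rfl⟩ := Nat.exists_eq_add_of_le hq
    refine hu.2 _ hv (List.IsPrefix.isInfix ?_)
    refine List.prefix_of_prefix_length_le ?_ hpre
      (by simp only [List.length_append]; omega)
    rw [List.replicate_add, List.flatten_append, List.append_assoc]
    simp [List.replicate]

theorem exists_length_le_of_prefix_iter [Finite A] {η : A → List A} (hη : ∀ a, η a ≠ []) {k : ℕ}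
    (hk : 0 < k) (hF : ∀ c ∈ F, iter η k c = [c]) :
    ∃ D, ∀ j c u, FifthPowerFree F u → u <+: iter η j c → u.length ≤ D := by
  obtain ⟨N, hN, E, hFE, hE, hsplit⟩ := exists_power_split hF
  obtain ⟨ζ, hζ⟩ : ∃ ζ, ζ = iter (iter η k) N := ⟨_, rfl⟩
  have hζF : ∀ c ∈ F, ζ c = [c] := hζ ▸ iter_eq_self hF N
  have hζ0 : ∀ a, ζ a ≠ [] := hζ ▸ iter_ne_nil (iter_ne_nil hη k) N
  rw [← hζ] at hE hsplit
  obtain ⟨L, hL⟩ : ∃ L, ∀ c, (ζ c).length ≤ L := by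
    obtain ⟨L, hL⟩ := (Set.finite_range fun c => (ζ c).length).bddAbove
    exact ⟨L, fun c => hL ⟨c, rfl⟩⟩
  have hL1 (c : A) : 1 ≤ L := (Nat.succ_le_of_lt (List.length_pos_of_ne_nil (hζ0 c))).trans (hL c)
  have hEL (q : ℕ) (c : A) (hc : c ∈ E) : (iter ζ q c).length ≤ L := by
    cases q with
    | zero => simpa using hL1 c
    | succ q =>
      rw [iter_succ, flatMap_eq_self (iter_eq_self hζF q) (hE c hc)]
      exact hL c
  have hmain (q : ℕ) (c : A) (u : List A) (hu : FifthPowerFree F u) (h : u <+: iter ζ q c) :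
      u.length ≤ L * L + (5 * (L * L) + L) := by
    by_cases hc : c ∈ E
    · exact (h.length_le.trans (hEL q c hc)).trans (by omega)
    obtain ⟨α, d, β, h1, h2, h3, α', β', h4, h5⟩ := hsplit c hc
    have hd : d ∉ F := fun hd => h3 (hFE hd)
    have hα : α.length ≤ L := by
      have := hL c
      rw [h1, List.length_append] at this
      omega
    have hα' : α'.length ≤ L := by
      have := hL d
      rw [h4, List.length_append] at this
      omega
    have hα'' : (α'.flatMap ζ).length ≤ L * L :=
      (length_flatMap_le fun a _ => hL a).trans (Nat.mul_le_mul_right L hα')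
    cases q with
    | zero =>
      have := h.length_le
      have := hL1 c
      rw [iter_zero, List.length_singleton] at *
      omega
    | succ q =>
      have hX : (α.flatMap (iter ζ q)).length ≤ L * L :=
        (length_flatMap_le fun a ha => hEL q a (h2 a ha)).trans (Nat.mul_le_mul_right L hα)
      rw [iter_succ, h1, List.flatMap_append, List.flatMap_cons] at h
      obtain h' | ⟨t, rfl, h'⟩ := prefix_append_cases h
      · have := h'.length_le
        omega
      have ht := FifthPowerFree.of_infix t _ hu (List.suffix_append _ _).isInfix
      have hdt : t <+: iter ζ q d := by
        obtain h' | ⟨s, rfl, -⟩ := prefix_append_cases h'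
        · exact h'
        · refine absurd (ht.1 d (List.mem_append_left _ ?_)) hd
          cases q with
          | zero => simp
          | succ q =>
            obtain ⟨γ, hγ⟩ := iter_of_split hζF hE h4 h5 q
            simp [hγ]
      have := length_le_of_prefix_split hζ0 hζF hE h4 h5 hd q ht hdt
      rw [List.length_append]
      omega
  -- Exponents not divisible by `k * N`: the remainder `r` is applied first and gives at most `R`
  -- letters, each contributing a bounded amount.
  obtain ⟨R, hR⟩ : ∃ R, ∀ c, ∀ r < k * N, (iter η r c).length ≤ R := by
    obtain ⟨R, hR⟩ := (Set.finite_range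
      fun p : A × Fin (k * N) => (iter η p.2 p.1).length).bddAbove
    exact ⟨R, fun c r hr => hR ⟨(c, ⟨r, hr⟩), rfl⟩⟩
  refine ⟨R * (L * L + (5 * (L * L) + L)), fun j c u hu h => ?_⟩
  rw [← Nat.div_add_mod j (k * N), iter_add, ← iter_iter, ← iter_iter, ← hζ] at h
  exact (length_le_of_prefix_flatMap FifthPowerFree.of_infix (fun c _ => hmain _ c) hu h).trans
    (Nat.mul_le_mul_right _ (hR c _ (Nat.mod_lt _ (Nat.mul_pos hk hN))))

/-- If `η^k` fixes the letters in `F`, then the words over `F` without fifth powers that occur in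
some `η^j(c)` have bounded length. -/
theorem exists_length_le_of_fifthPowerFree [Finite A] {η : A → List A} (hη : ∀ a, η a ≠ [])
    {k : ℕ} (hk : 0 < k) (hF : ∀ c ∈ F, iter η k c = [c]) :
    ∃ D, ∀ j c u, FifthPowerFree F u → u <:+: iter η j c → u.length ≤ D := by
  refine exists_length_le_of_infix_iter FifthPowerFree.of_infix
    (exists_length_le_of_prefix_iter hη hk hF) ?_
  obtain ⟨D, hD⟩ := exists_length_le_of_prefix_iter (F := F) (η := fun a => (η a).reverse)
    (fun a => by simpa using hη a) hk fun c hc => by rw [iter_reverse, hF c hc]; rfl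
  refine ⟨D, fun j c u hu h => ?_⟩
  rw [← List.length_reverse]
  refine hD j c _ hu.reverse ?_
  rw [iter_reverse]
  exact List.reverse_prefix.2 h

end Frozen

/-! ### No substitution generates the doubled system -/

section Substitution

variable {A : Type*}

theorem prefix_of_occursAt {u v : List A} {x : ℤ → A} {i : ℤ} (hu : OccursAt u x i)
    (hv : OccursAt v x i) (h : u.length ≤ v.length) : u <+: v := by
  rw [← List.take_append_drop u.length v, occursAt_append] at hv
  rw [hu.eq_of_length_eq hv.1 (by simp [h])]
  exact List.take_prefix _ _

theorem suffix_of_occursAt {u v : List A} {x : ℤ → A} {i k : ℤ} (hu : OccursAt u x i)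
    (hv : OccursAt v x k) (hik : i + u.length = k + v.length) (h : u.length ≤ v.length) :
    u <:+ v := by
  rw [← List.take_append_drop (v.length - u.length) v, occursAt_append] at hv
  have h2 := hv.2
  rw [List.length_take, show k + ((min (v.length - u.length) v.length : ℕ) : ℤ) = i by omega] at h2
  rw [hu.eq_of_length_eq h2 (by rw [List.length_drop]; omega)]
  exact List.drop_suffix _ _

/-- The only substitution that maps a sequence of the doubled system to another one is the
identity. -/
theorem eq_id_of_isImage {θ : Fin 2 → List (Fin 2)} (hθ : ∀ a, θ a ≠ []) {y z : ℤ → Fin 2}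
    (hy : y ∈ doubledSystem) (hz : z ∈ doubledSystem) (h : IsImage θ y z) (a : Fin 2) :
    θ a = [a] := by
  have hocc (u : List (Fin 2)) (hu : u <:+: [1, 0, 0, 0, 0, 1, 0, 0, 1]) :
      Occurs (u.flatMap θ) z := h.occurs_flatMap ((occurs_100001001 hy).of_infix hu)
  have h0 : θ 0 = [0] := by
    refine (doubled_fourth_power_iff hz (hθ 0)).1 ?_
    simpa using hocc [0, 0, 0, 0] (by decide)
  obtain rfl | rfl : a = 0 ∨ a = 1 := by omega
  · exact h0
  -- An outer 0 in `θ 1` would join the image of 0000 to form 00000.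
  obtain ⟨t, ht⟩ : ∃ t, θ 1 = 1 :: t := by
    obtain ⟨b, t, hbt⟩ := List.exists_cons_of_ne_nil (hθ 1)
    obtain rfl | rfl : b = 0 ∨ b = 1 := by omega
    · refine absurd ?_ (doubled_not_occurs_00000 hz)
      refine (hocc [0, 0, 0, 0, 1] (by decide)).of_infix ⟨[], t, ?_⟩
      simp [h0, hbt]
    · exact ⟨t, hbt⟩
  obtain ⟨s, hs⟩ : ∃ s, θ 1 = s ++ [1] := by
    obtain ⟨s, b, hbs⟩ := (List.eq_nil_or_concat' (θ 1)).resolve_left (hθ 1)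
    obtain rfl | rfl : b = 0 ∨ b = 1 := by omega
    · refine absurd ?_ (doubled_not_occurs_00000 hz)
      refine (hocc [1, 0, 0, 0, 0] (by decide)).of_infix ⟨s, [], ?_⟩
      simp [h0, hbs]
    · exact ⟨s, hbs⟩
  by_contra hne
  have hlen : s.length = t.length := by
    have := congrArg List.length (hs.symm.trans ht)
    simpa using this
  have ht0 : t ≠ [] := by
    rintro rfl
    exact hne ht
  have hs0 : s ≠ [] := by
    rw [ne_eq, ← List.length_eq_zero_iff, hlen, List.length_eq_zero_iff]
    exact ht0
  have h1t : (1 : Fin 2) ∈ t := by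
    obtain ⟨t', b, rfl⟩ := (List.eq_nil_or_concat' t).resolve_left ht0
    have := hs.symm.trans ht
    rw [← List.cons_append] at this
    obtain rfl : 1 = b := by simpa using List.append_inj_right' this rfl
    simp
  have h1s : (1 : Fin 2) ∈ s := by
    obtain ⟨b, s', rfl⟩ := List.exists_cons_of_ne_nil hs0
    have := hs.symm.trans ht
    rw [List.cons_append, List.cons_eq_cons] at this
    simp [this.1]
  obtain ⟨i, hi⟩ := hocc [1, 0, 0, 1] (by decide)
  -- The central 1001 consists of the last 1 of `θ 1`, the image of 00 and the first 1 of the next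
  -- `θ 1`. Its forced neighbours 0000 then lie inside `t` and `s`, both of which contain a 1.
  have hi' : OccursAt (s ++ ([1, 0, 0, 1] ++ t)) z i := by
    have : [1, 0, 0, 1].flatMap θ = s ++ ([1, 0, 0, 1] ++ t) := by
      simp only [List.flatMap_cons, List.flatMap_nil, h0]
      nth_rw 1 [hs]
      rw [ht]
      simp
    rwa [this] at hi
  rw [occursAt_append, occursAt_append] at hi'
  obtain ⟨his, him, hit⟩ := hi'
  have hafter := doubled_after_1001 hz him
  have hbefore := doubled_before_1001 hz him
  have hzeros : ∀ u : List (Fin 2), u <:+: [0, 0, 0, 0] → (1 : Fin 2) ∉ u :=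
    fun u hu h => absurd (hu.subset h) (by decide)
  have htp : [0, 0, 0, 0] <+: t := by
    have hafter' : OccursAt [0, 0, 0, 0] z (i + s.length + 4) :=
      (occursAt_append (u := [0, 0, 0, 0]) (v := [1]).1 hafter).1
    rcases le_total 4 t.length with hle | hle
    · exact prefix_of_occursAt hafter' hit hle
    · exact absurd h1t (hzeros t (prefix_of_occursAt hit hafter' hle).isInfix)
  have hsp : [0, 0, 0, 0] <:+ s := by
    have hbefore' : OccursAt [0, 0, 0, 0] z (i + s.length - 4) := by
      have := (occursAt_append (u := [1]) (v := [0, 0, 0, 0]).1 hbefore).2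
      convert this using 1
      simp
      ring
    rcases le_total 4 s.length with hle | hle
    · exact suffix_of_occursAt hbefore' his (by simp) hle
    · exact absurd h1s (hzeros s (suffix_of_occursAt his hbefore' (by simp) hle).isInfix)
  obtain ⟨t', rfl⟩ := htp
  obtain ⟨s', rfl⟩ := hsp
  -- Now `θ 1` starts with 10000 and ends with 00001, so the image of 100001 contains the forbidden
  -- word.
  refine doubled_not_occurs_00001000010000 hz
    ((hocc [1, 0, 0, 0, 0, 1] (by decide)).of_infix ⟨s', t', ?_⟩)
  simp only [List.flatMap_cons, List.flatMap_nil, h0]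
  nth_rw 1 [hs]
  rw [ht]
  simp

/-- Both letters occur in `y`, so their images occur in the embedded `z` and are words over the
range of `e`. This reduces the claim to the alphabet `Fin 2`. -/
theorem eq_id_of_isImage_map {e : Fin 2 → A} (he : Function.Injective e) {ζ : A → List A}
    (hζ : ∀ a, ζ a ≠ []) {y z : ℤ → Fin 2} (hy : y ∈ doubledSystem) (hz : z ∈ doubledSystem)
    (h : IsImage ζ (fun n => e (y n)) (fun n => e (z n))) : ∀ c ∈ Set.range e, ζ c = [c] := by
  have hrange (a : Fin 2) : ∃ w : List (Fin 2), ζ (e a) = w.map e := by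
    have hya : Occurs [a] y := (occurs_100001001 hy).of_infix (by revert a; decide)
    obtain ⟨n, hn⟩ := hya
    have hn' : OccursAt [e a] (fun n => e (y n)) n := (occursAt_map he (w := [a])).2 hn
    obtain ⟨m, hm⟩ := h.occurs_flatMap hn'.occurs
    have hm' : OccursAt ([e a].flatMap ζ) (fun n => e (z n)) m := hm
    rw [List.flatMap_singleton] at hm'
    refine ⟨window z m (ζ (e a)).length, ?_⟩
    exact hm'.eq_of_length_eq ((occursAt_map he).2 (occursAt_window z m _)) (by simp)
  choose θ hθ using hrange
  have hθ0 (a : Fin 2) : θ a ≠ [] := by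
    intro h0
    exact hζ (e a) (by rw [hθ, h0]; rfl)
  have himage : IsImage θ y z := by
    obtain ⟨c, h0, hc⟩ := isImage_iff.1 h
    refine isImage_iff.2 ⟨c, h0, fun n => ?_⟩
    have := hc n
    simp only [hθ, occursAt_map he, List.length_map] at this
    exact this
  rintro _ ⟨a, rfl⟩
  rw [hθ, eq_id_of_isImage hθ0 hy hz himage a]
  rfl

theorem fifthPowerFree_window {e : Fin 2 → A} (he : Function.Injective e) {y : ℤ → Fin 2}
    (hy : y ∈ doubledSystem) (i : ℤ) (n : ℕ) :
    FifthPowerFree (Set.range e) (window (fun n => e (y n)) i n) := by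
  constructor
  · intro a ha
    obtain ⟨j, rfl⟩ := mem_of_mem_window ha
    exact ⟨y j, rfl⟩
  · intro v hv h
    obtain ⟨m, hm⟩ := ((occursAt_window _ i n).occurs).of_infix h
    have hm' : OccursAt (v ++ v ++ v ++ v ++ v) (fun n => e (y n)) m := hm
    have hw : v = (window y m v.length).map e := by
      simp only [List.append_assoc] at hm'
      exact (occursAt_append.1 hm').1.eq_of_length_eq
        ((occursAt_map he).2 (occursAt_window y m _)) (by simp)
    generalize window y m v.length = w at hw
    subst hw
    simp only [← List.map_append] at hm'
    have hw5 := ((occursAt_map he).1 hm').occurs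
    have hw0 : w = [0] :=
      (doubled_fourth_power_iff hy (by simpa using hv)).1 (hw5.of_infix ⟨[], w, rfl⟩)
    subst hw0
    exact doubled_not_occurs_00000 hy hw5

theorem mem_system_of_isImage {η : A → List A} (hη : ∀ a, η a ≠ []) {x y : ℤ → A}
    (hx : x ∈ system η) (h : IsImage η x y) : y ∈ system η := by
  intro i n
  obtain ⟨j, m, hjm⟩ := h.window_infix hη i n
  obtain ⟨a, k, hk⟩ := hx j m
  refine ⟨a, k + 1, List.IsInfix.trans hjm ?_⟩
  rw [iter_succ']
  exact infix_flatMap _ hk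

theorem map_not_mem_system [Finite A] {η : A → List A} (hη : ∀ a, η a ≠ []) {e : Fin 2 → A}
    (he : Function.Injective e) {y z : ℤ → Fin 2} (hy : y ∈ doubledSystem)
    (hz : z ∈ doubledSystem) {k : ℕ} (hk : 0 < k)
    (h : IsImage (iter η k) (fun n => e (y n)) (fun n => e (z n))) :
    (fun n => e (y n)) ∉ system η := by
  intro hsys
  obtain ⟨D, hD⟩ := exists_length_le_of_fifthPowerFree hη hk
    (eq_id_of_isImage_map he (iter_ne_nil hη k) hy hz h)
  obtain ⟨a, j, haj⟩ := hsys 0 (D + 1)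
  have := hD j a _ (fifthPowerFree_window he hy 0 (D + 1)) haj
  rw [length_window] at this
  omega

theorem doubledSystem_nonempty : doubledSystem.Nonempty := by
  rw [doubledSystem_eq]
  exact ⟨_, fibPoint, fibPoint_mem_fibSystem, rfl⟩

end Substitution

end FibDouble

theorem mainTheorem7 :
    -- the system is obtained from the Fibonacci system by doubling the 0's
    FibDouble.doubledSystem =
      {y : ℤ → Fin 2 | ∃ x ∈ FibDouble.fibSystem, ∃ z : ℤ → Fin 2,
        FibDouble.IsImage FibDouble.double x z ∧ ∃ k : ℤ, y = FibDouble.shift k z} ∧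
    -- it is conjugate to the Fibonacci system
    FibDouble.Conjugate FibDouble.fibSystem FibDouble.doubledSystem ∧
    -- each of its sequences contains 0000, and no other fourth power
    (∀ y ∈ FibDouble.doubledSystem, ∀ w : List (Fin 2), w ≠ [] →
      (FibDouble.Occurs (w ++ w ++ w ++ w) y ↔ w = [0])) ∧
    -- no substitution on a finite alphabet containing 0 and 1 generates it, neither as the
    -- system of its language nor as the orbit closure of an admissible periodic point
    (∀ (A : Type) [Finite A] [TopologicalSpace A] [DiscreteTopology A]
      (η : A → List A) (_ : ∀ a, η a ≠ []) (e : Fin 2 → A) (_ : Function.Injective e),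
      FibDouble.system η ≠
        (fun (y : ℤ → Fin 2) (n : ℤ) => e (y n)) '' FibDouble.doubledSystem ∧
      ∀ x ∈ FibDouble.system η, ∀ k : ℕ, 1 ≤ k →
        FibDouble.IsImage (FibDouble.iter η k) x x →
        FibDouble.orbitClosure x ≠
          (fun (y : ℤ → Fin 2) (n : ℤ) => e (y n)) '' FibDouble.doubledSystem) := by
  open FibDouble in
  refine ⟨doubledSystem_eq_shifts, conjugate_fibSystem_doubledSystem,
    fun y hy w hw => doubled_fourth_power_iff hy hw, fun A _ _ _ η hη e he => ⟨?_, ?_⟩⟩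
  · intro heq
    obtain ⟨y, hy⟩ := doubledSystem_nonempty
    have hys : (fun n => e (y n)) ∈ system η := by
      rw [heq]
      exact ⟨y, hy, rfl⟩
    obtain ⟨v, hv⟩ := exists_isImage hη fun n => e (y n)
    obtain ⟨z, hz, rfl⟩ : v ∈ (fun (y : ℤ → Fin 2) (n : ℤ) => e (y n)) '' doubledSystem := by
      rw [← heq]
      exact mem_system_of_isImage hη hys hv
    exact map_not_mem_system hη he hy hz one_pos (by rwa [iter_one]) hys
  · intro x hx k hk hxk heq
    obtain ⟨y, hy, rfl⟩ : x ∈ (fun (y : ℤ → Fin 2) (n : ℤ) => e (y n)) '' doubledSystem := by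
      rw [← heq]
      exact mem_orbitClosure_self x
    exact map_not_mem_system hη he hy hy hk hxk hx
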